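/- Fix a finite nonempty set $\mathrm{AP}=\{0,\dots,m-1\}$ ($m\ge 1$) of atomic propositions and put $\Sigma=2^{\mathrm{AP}}$. A $\Sigma$-tree is a rooted, unordered, $\Sigma$-labelled tree in which every node has finitely many, and at least one, successors. A tree language is a set of $\Sigma$-trees. **Logics.** PastCTL$_\pm$ formulae are given by $$\varphi ::= p \mid \neg\varphi \mid \varphi\lor\varphi \mid \mathsf D^n\varphi \mid \mathsf{EX}\varphi \mid \mathsf E(\varphi\,\mathsf U\,\varphi) \mid \mathsf{EY}\varphi \mid \mathsf E(\varphi\,\mathsf S\,\varphi)\qquad(p\in\mathrm{AP},\ n\in\mathbb N).$$ They are interpreted at nodes $u$ of $\Sigma$-trees: $\mathsf D^n\varphi$ says that at least $n$ distinct successors of $u$ satisfy $\varphi$, the quantifier $\mathsf E$ ranges over the infinite paths that start at the root and visit $u$, and $\mathsf X$ (next), $\mathsf U$ (until), $\mathsf Y$ (yesterday, false at the root), $\mathsf S$ (since) have their usual non-strict meaning on the path at the position of $u$. CTL$_\pm$ is the fragment without $\mathsf{EY}$ and $\mathsf{ES}$. The language of $\varphi$ is the set of trees whose root satisfies $\varphi$.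 **Automata.** A graded tree automaton is a tuple $\langle Q,\Sigma,\delta,q_I,F\rangle$ with $Q$ finite, $q_I\in Q$, $F\subseteq Q$ and $\delta\colon Q\times\Sigma\to\mathcal B^+(\{\diamond_k,\square_k\}_{k\in\mathbb N}\times Q)$, where $\mathcal B^+$ denotes positive Boolean formulae. An initial run on $t$ is a finitely branching tree labelled in $Q\times\mathrm{Dom}(t)$ whose root is labelled by $q_I$ and the root of $t$, and in which every node with label $(q,v)$ satisfies $\delta(q,t(v))$: the atom $(\diamond_k,q')$ asks for children with labels $(q',v_1),\dots,(q',v_k)$ for $k$ distinct successors $v_i$ of $v$, and $(\square_k,q')$ asks for a child labelled $(q',v')$ for all but fewer than $k$ of the successors $v'$ of $v$. A run may have leaves, where the transition condition requires no child. It is accepting if every infinite path visits $F$ infinitely often; the language of the automaton is the set of trees that have an initial accepting run. The automaton is a (one-way) *linear* HTA$_\pm$ if there is a total order on $Q$ such that every state occurring in $\delta(q,\sigma)$ is $\le q$, and every state $q$ is either *transient* ($q$ does not occur in any $\delta(q,\sigma)$), or *existential* ($q$ occurs in the formulae $\delta(q,\sigma)$ only in the atom $(\diamond_1,q)$) with $q\notin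 F$, or *universal* ($q$ occurs in them only in the atom $(\square_1,q)$) with $q\in F$. (This is the case of singleton components of a hesitant partition; then the general requirement that a clause of the disjunctive, respectively conjunctive, normal form contains at most one atom of the component is automatic.) In a *two-way linear* HTA$_\pm$ the transition function may moreover depend on whether the current node is the root, and may use atoms $(\Uparrow,q')$, which ask for a child labelled $(q',v')$ with $v'$ the parent of $v$ (and fail at the root); a state $q$ may then also be *upward*: it occurs in its own transition formulae only in the atom $(\Uparrow,q)$. **Expressiveness.** Two formalisms are equivalent if there are computable translations in both directions that preserve the tree language. A formalism is strictly less expressive than another one if there is a computable language-preserving translation from the former to the latter, and some tree language definable in the latter is not definable in the former. **Theorem.** For every such $\mathrm{AP}$: 1. one-way linear HTA$_\pm$ and CTL$_\pm$ are equivalent formalisms; 2. CTL$_\pm$ is strictly less expressive than PastCTL$_\pm$; 3. one-way linear HTA$_\pm$ are strictly less expressive than two-way linear HTA$_\pm$. -/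

import Mathlib

namespace HTA

/-! ### Trees -/

/-- A finitely branching rooted tree with labels in `α`; `succ u v` means that `v` is a successor
(child) of `u`.  Leaves are allowed here; they are forbidden in `SigmaTree`. -/
structure LabTree (α : Type) where
  Node : Type
  root : Node
  succ : Node → Node → Prop
  label : Node → α
  root_no_pred : ∀ u, ¬ succ u root
  pred_unique : ∀ u u' v, succ u v → succ u' v → u = u'
  reachable : ∀ v, Relation.ReflTransGen succ root v
  finite_succ : ∀ u, {v | succ u v}.Finite

/-- Unranked, unordered, leafless trees labelled over `α`. -/
structure SigmaTree (α : Type) extends LabTree α where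
  leafless : ∀ u, ∃ v, succ u v

/-- Infinite paths, not necessarily starting at the root. -/
def LabTree.IsPath {α : Type} (t : LabTree α) (π : ℕ → t.Node) : Prop :=
  ∀ i, t.succ (π i) (π (i + 1))

/-- Infinite paths starting at the root. -/
def LabTree.IsInitialPath {α : Type} (t : LabTree α) (π : ℕ → t.Node) : Prop :=
  π 0 = t.root ∧ t.IsPath π

/-- The set `AP` of atomic propositions is `{0, …, m - 1}`, and the alphabet is `2 ^ AP`. -/
abbrev Letter (m : ℕ) : Type := Finset (Fin m)

abbrev TreeLanguage (m : ℕ) : Type 1 := Set (SigmaTree (Letter m))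

/-! ### Polarised (Past)CTL -/

/-- Syntax of polarised PastCTL: `p`, `¬ φ`, `φ ∨ ψ`, `Dⁿ φ`, `E X φ`, `E (φ U ψ)`, `E Y φ`,
`E (φ S ψ)`. -/
inductive Formula (m : ℕ) : Type
  | atom (p : Fin m)
  | neg (φ : Formula m)
  | or (φ ψ : Formula m)
  | count (n : ℕ) (φ : Formula m)
  | EX (φ : Formula m)
  | EU (φ ψ : Formula m)
  | EY (φ : Formula m)
  | ES (φ ψ : Formula m)

/-- The satisfaction relation `(t, u) ⊨ φ`, with the history-preserving path quantifier:
`E` ranges over the infinite paths that start at the root and visit `u` at some position `i`. -/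
def Formula.Sat {m : ℕ} (t : SigmaTree (Letter m)) : Formula m → t.Node → Prop
  | .atom p, u => p ∈ t.label u
  | .neg φ, u => ¬ φ.Sat t u
  | .or φ ψ, u => φ.Sat t u ∨ ψ.Sat t u
  | .count n φ, u => ∃ S : Finset t.Node, S.card = n ∧ ∀ v ∈ S, t.succ u v ∧ φ.Sat t v
  | .EX φ, u => ∃ π i, t.IsInitialPath π ∧ π i = u ∧ φ.Sat t (π (i + 1))
  | .EU φ ψ, u => ∃ π i, t.IsInitialPath π ∧ π i = u ∧
      ∃ j, i ≤ j ∧ ψ.Sat t (π j) ∧ ∀ k, i ≤ k → k < j → φ.Sat t (π k)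
  | .EY φ, u => ∃ π i, t.IsInitialPath π ∧ π i = u ∧ 0 < i ∧ φ.Sat t (π (i - 1))
  | .ES φ ψ, u => ∃ π i, t.IsInitialPath π ∧ π i = u ∧
      ∃ j, j ≤ i ∧ ψ.Sat t (π j) ∧ ∀ k, j < k → k ≤ i → φ.Sat t (π k)

/-- The set of models of a formula, evaluated at the root. -/
def Formula.lang {m : ℕ} (φ : Formula m) : TreeLanguage m := {t | φ.Sat t t.root}

/-- The formulae without past operators: the fragment polarised CTL. -/
def Formula.PastFree {m : ℕ} : Formula m → Prop
  | .atom _ => True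
  | .neg φ => φ.PastFree
  | .or φ ψ => φ.PastFree ∧ ψ.PastFree
  | .count _ φ => φ.PastFree
  | .EX φ => φ.PastFree
  | .EU φ ψ => φ.PastFree ∧ ψ.PastFree
  | .EY _ => False
  | .ES _ _ => False

/-- Gödel numbering of formulae. -/
def Formula.code {m : ℕ} : Formula m → ℕ
  | .atom p => Nat.pair 0 p
  | .neg φ => Nat.pair 1 φ.code
  | .or φ ψ => Nat.pair 2 (Nat.pair φ.code ψ.code)
  | .count n φ => Nat.pair 3 (Nat.pair n φ.code)
  | .EX φ => Nat.pair 4 φ.code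
  | .EU φ ψ => Nat.pair 5 (Nat.pair φ.code ψ.code)
  | .EY φ => Nat.pair 6 φ.code
  | .ES φ ψ => Nat.pair 7 (Nat.pair φ.code ψ.code)

/-! ### Positive Boolean formulae -/

inductive PBF (X : Type) : Type
  | tt
  | ff
  | atom (x : X)
  | and (θ η : PBF X)
  | or (θ η : PBF X)

namespace PBF

variable {X : Type}

def Sat (s : X → Prop) : PBF X → Prop
  | tt => True
  | ff => False
  | atom x => s x
  | and θ η => θ.Sat s ∧ η.Sat s
  | or θ η => θ.Sat s ∨ η.Sat s

/-- The atoms occurring in a formula. -/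
def atoms : PBF X → Set X
  | tt => ∅
  | ff => ∅
  | atom x => {x}
  | and θ η => θ.atoms ∪ η.atoms
  | or θ η => θ.atoms ∪ η.atoms

/-- The clauses of the disjunctive normal form, each given as its set of atoms. -/
def dnf : PBF X → Set (Set X)
  | tt => {∅}
  | ff => ∅
  | atom x => {{x}}
  | and θ η => {C | ∃ C₁ ∈ θ.dnf, ∃ C₂ ∈ η.dnf, C = C₁ ∪ C₂}
  | or θ η => θ.dnf ∪ η.dnf

/-- The clauses of the conjunctive normal form, each given as its set of atoms. -/
def cnf : PBF X → Set (Set X)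
  | tt => ∅
  | ff => {∅}
  | atom x => {{x}}
  | and θ η => θ.cnf ∪ η.cnf
  | or θ η => {C | ∃ C₁ ∈ θ.cnf, ∃ C₂ ∈ η.cnf, C = C₁ ∪ C₂}

/-- Gödel numbering, relative to a numbering of the atoms. -/
def code (c : X → ℕ) : PBF X → ℕ
  | tt => Nat.pair 0 0
  | ff => Nat.pair 0 1
  | atom x => Nat.pair 1 (c x)
  | and θ η => Nat.pair 2 (Nat.pair (θ.code c) (η.code c))
  | or θ η => Nat.pair 3 (Nat.pair (θ.code c) (η.code c))

end PBF

/-! ### Graded tree automata -/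

/-- Head movements: `◇ₖ` and `□ₖ`, and `⇑` for two-way automata only (`w = true`). -/
inductive Move : Bool → Type
  | dia {w : Bool} (k : ℕ) : Move w
  | box {w : Bool} (k : ℕ) : Move w
  | up : Move true

def Move.code : {w : Bool} → Move w → ℕ
  | _, .dia k => Nat.pair 0 k
  | _, .box k => Nat.pair 1 k
  | _, .up => Nat.pair 2 0

/-- Alternating graded Büchi tree automata with state set `{0, …, numStates - 1}`.  The type `I` is
what the automaton observes at the current node: a letter for one-way automata, a letter and the
information whether the node is the root for two-way automata. -/
structure Automaton (I : Type) (w : Bool) where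
  numStates : ℕ
  δ : Fin numStates → I → PBF (Move w × Fin numStates)
  init : Fin numStates
  acc : Finset (Fin numStates)

namespace Automaton

variable {I : Type} {w : Bool} {α : Type}

/-- When a node `u` of a candidate run `r` on the input tree `t` satisfies an atom. -/
def AtomSat {n : ℕ} (t : SigmaTree α) (r : LabTree (Fin n × t.Node)) (u : r.Node) :
    Move w × Fin n → Prop
  | (.dia k, q') => ∃ S : Finset t.Node, S.card = k ∧
      ∀ v' ∈ S, t.succ (r.label u).2 v' ∧ ∃ u', r.succ u u' ∧ r.label u' = (q', v')
  | (.box k, q') => {v' | t.succ (r.label u).2 v' ∧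
      ¬ ∃ u', r.succ u u' ∧ r.label u' = (q', v')}.ncard < k
  | (.up, q') => ∃ v' u', t.succ v' (r.label u).2 ∧ r.succ u u' ∧ r.label u' = (q', v')

/-- `r` is a run of `A` on `t` starting from the node `s`; `obs v` is what `A` observes at `v`.
A node of `r` whose transition condition requires no child may be a leaf of `r`. -/
def IsRun (A : Automaton I w) (t : SigmaTree α) (obs : t.Node → I) (s : t.Node)
    (r : LabTree (Fin A.numStates × t.Node)) : Prop :=
  r.label r.root = (A.init, s) ∧
  ∀ u, (A.δ (r.label u).1 (obs (r.label u).2)).Sat (AtomSat t r u)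

/-- The Büchi condition: every infinite path of the run visits `acc` infinitely often. -/
def IsAccepting (A : Automaton I w) (t : SigmaTree α)
    (r : LabTree (Fin A.numStates × t.Node)) : Prop :=
  ∀ π : ℕ → r.Node, r.IsPath π → ∃ᶠ i in Filter.atTop, (r.label (π i)).1 ∈ A.acc

/-- Existence of an initial accepting run. -/
def Accepts (A : Automaton I w) (t : SigmaTree α) (obs : t.Node → I) : Prop :=
  ∃ r, A.IsRun t obs t.root r ∧ A.IsAccepting t r

/-! A partition of the states into totally ordered components is given by a map `c` to `ℕ`: the
components are the nonempty sets `{q | c q = i}`, ordered by `i`. -/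

/-- Transitions stay in a component or move to a lower one. -/
def Ordered (A : Automaton I w) (c : Fin A.numStates → ℕ) : Prop :=
  ∀ q x, ∀ a ∈ (A.δ q x).atoms, c a.2 ≤ c q

def Transient (A : Automaton I w) (c : Fin A.numStates → ℕ) (i : ℕ) : Prop :=
  ∀ q, c q = i → ∀ x, ∀ a ∈ (A.δ q x).atoms, c a.2 ≠ i

def Existential (A : Automaton I w) (c : Fin A.numStates → ℕ) (i : ℕ) : Prop :=
  ∀ q, c q = i → ∀ x,
    (∀ a ∈ (A.δ q x).atoms, c a.2 = i → a.1 = Move.dia 1) ∧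
    ∀ C ∈ (A.δ q x).dnf, {a ∈ C | c a.2 = i}.Subsingleton

def Universal (A : Automaton I w) (c : Fin A.numStates → ℕ) (i : ℕ) : Prop :=
  ∀ q, c q = i → ∀ x,
    (∀ a ∈ (A.δ q x).atoms, c a.2 = i → a.1 = Move.box 1) ∧
    ∀ C ∈ (A.δ q x).cnf, {a ∈ C | c a.2 = i}.Subsingleton

/-- Only used for two-way automata all of whose components are singletons. -/
def Upward (A : Automaton I true) (c : Fin A.numStates → ℕ) (i : ℕ) : Prop :=
  ∀ q, c q = i → ∀ x, ∀ a ∈ (A.δ q x).atoms, c a.2 = i → a.1 = Move.up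

/-- The component `i` is existential and consists of states outside `acc`. -/
def PolExistential (A : Automaton I w) (c : Fin A.numStates → ℕ) (i : ℕ) : Prop :=
  A.Existential c i ∧ ∀ q, c q = i → q ∉ A.acc

/-- The component `i` is universal and consists of states in `acc`. -/
def PolUniversal (A : Automaton I w) (c : Fin A.numStates → ℕ) (i : ℕ) : Prop :=
  A.Universal c i ∧ ∀ q, c q = i → q ∈ A.acc

/-- Gödel number of an automaton, where `xs` lists all possible observations: the initial state,
the table of the transition function, and the table of the accepting states. -/
def code (xs : List I) (A : Automaton I w) : ℕ :=
  Encodable.encode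
    ((A.init : ℕ),
     List.ofFn (fun q => xs.map fun x =>
       (A.δ q x).code fun a => Nat.pair a.1.code (a.2 : ℕ)),
     List.ofFn (fun q => decide (q ∈ A.acc)))

end Automaton

/-- All letters over `{0, …, m - 1}`, in the order of their characteristic bit strings. -/
def letters (m : ℕ) : List (Letter m) :=
  (List.range (2 ^ m)).map fun s => Finset.univ.filter fun i : Fin m => s.testBit i = true

/-! ### One-way automata -/

/-- Graded tree automata over `2 ^ AP`. -/
abbrev GTA (m : ℕ) : Type := Automaton (Letter m) false

def GTA.lang {m : ℕ} (A : GTA m) : TreeLanguage m := {t | A.Accepts t t.label}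

/-- `A` is a polarised hesitant tree automaton, as witnessed by the partition `c`. -/
def GTA.IsPolarisedHesitant {m : ℕ} (A : GTA m) (c : Fin A.numStates → ℕ) : Prop :=
  A.Ordered c ∧
  ∀ i ∈ Set.range c, A.Transient c i ∨ A.PolExistential c i ∨ A.PolUniversal c i

/-- Linear polarised hesitant tree automata: every component is a singleton. -/
def GTA.IsLinear {m : ℕ} (A : GTA m) : Prop :=
  ∃ c : Fin A.numStates → ℕ, A.IsPolarisedHesitant c ∧ Function.Injective c

/-! ### Two-way automata -/

inductive Position : Type
  | root
  | nonRoot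

/-- Two-way graded tree automata over `2 ^ AP`. -/
abbrev TwoWayGTA (m : ℕ) : Type := Automaton (Letter m × Position) true

open Classical in
noncomputable def observe {m : ℕ} (t : SigmaTree (Letter m)) (v : t.Node) : Letter m × Position :=
  (t.label v, if v = t.root then .root else .nonRoot)

def TwoWayGTA.lang {m : ℕ} (A : TwoWayGTA m) : TreeLanguage m := {t | A.Accepts t (observe t)}

/-- Two-way linear polarised hesitant tree automata. -/
def TwoWayGTA.IsLinear {m : ℕ} (A : TwoWayGTA m) : Prop :=
  ∃ c : Fin A.numStates → ℕ, Function.Injective c ∧ A.Ordered c ∧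
    ∀ i ∈ Set.range c,
      A.Transient c i ∨ A.PolExistential c i ∨ A.PolUniversal c i ∨ A.Upward c i

/-! ### Formalisms and their expressive power -/

/-- A formalism for tree languages over `2 ^ AP`; its expressions have Gödel numbers, so that
effectiveness of translations makes sense. -/
structure Formalism (m : ℕ) where
  Expr : Type
  code : Expr → ℕ
  lang : Expr → TreeLanguage m

namespace Formalism

variable {m : ℕ}

/-- There is an effective (computable) translation of the expressions of `F` into expressions of
`G` that define the same tree language. -/
def TranslatesTo (F G : Formalism m) : Prop :=
  ∃ f : ℕ → ℕ, Computable f ∧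
    ∀ e : F.Expr, ∃ e' : G.Expr, G.code e' = f (F.code e) ∧ G.lang e' = F.lang e

/-- `F` and `G` are equivalent formalisms. -/
def Equivalent (F G : Formalism m) : Prop := F.TranslatesTo G ∧ G.TranslatesTo F

/-- `F` is strictly less expressive than `G`. -/
def StrictlyLess (F G : Formalism m) : Prop :=
  F.TranslatesTo G ∧ ∃ e : G.Expr, ∀ e' : F.Expr, F.lang e' ≠ G.lang e

end Formalism

def polPastCTL (m : ℕ) : Formalism m where
  Expr := Formula m
  code := Formula.code
  lang := Formula.lang

def polCTL (m : ℕ) : Formalism m where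
  Expr := {φ : Formula m // φ.PastFree}
  code φ := φ.1.code
  lang φ := φ.1.lang

def linearHTA (m : ℕ) : Formalism m where
  Expr := {A : GTA m // A.IsLinear}
  code A := A.1.code (letters m)
  lang A := A.1.lang

def twoWayLinearHTA (m : ℕ) : Formalism m where
  Expr := {A : TwoWayGTA m // A.IsLinear}
  code A := A.1.code ((letters m).map (·, .root) ++ (letters m).map (·, .nonRoot))
  lang A := A.1.lang

end HTA

/-!
Polarised CTL and one-way linear hesitant automata are translated into each other state by state,
and one language shows that the past adds expressive power to both.

**Acceptance.** In a linear automaton every infinite branch of a run ends up in a single state, so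
acceptance is a nested fixpoint of simple shape: once the meaning of the lower states is known, an
accepting state denotes a greatest fixpoint and any other state a least one.
`Automaton.IsValuation` certifies such a meaning by ranks, and
`Automaton.IsValuation.accepts_iff` shows that the automaton accepts exactly when its initial state
holds at the root. In one direction, a false label in a run could be pursued forever (nonaccepting
states) or down the ranks (accepting states); in the other, the run that visits only true labels and
decreases the rank in nonaccepting states is accepting.

**Formulae to automata.** The states are the Gödel numbers up to that of the formula, each in a
positive and a negative copy. The order of the numbers makes the automaton linear, since subformulae
have smaller numbers: `E (φ U ψ)` loops through `◇₁`, its negation through `□₁`, and nothing else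
loops. The transition table is primitive recursive by course-of-values recursion
(`primrec_deltaCode`).

**Automata to formulae.** Let `α` and `β` be the transition condition of a state `q` with its own
atoms made false and true. An existential state means the least fixpoint of `α ∨ (β ∧ ◇X)`, which is
`E (β U α)`, and a universal one the greatest fixpoint of `α ∨ (β ∧ □X)`, which is
`¬ E (¬α U ¬β)`; for a transient state `α` and `β` agree, and both formulae say the same
(`accepts_iff_sat`). The order of the states is not part of the input, so all formulae are
recomputed as often as there are states; that suffices for them to become correct from the bottom
up (`stateFormulas_stable`).

**Separation.** The language consists of the trees with a finite path from the root, along which the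
truth value of the first proposition changes in every step, to a node with a single successor. With
a yesterday operator or an upward move, each node can be compared with its parent. Without the past,
one cannot force the chosen successor to have the other label while continuing along it: in the
graph `LevelSucc` every past-free formula depends, from some level on, on the label only
(`exists_stableFrom`), but whether the path exists depends on the switch.
-/

namespace HTA

/-! ### Positive Boolean formulae -/

namespace PBF

variable {X Y : Type}

theorem Sat.mono {s s' : X → Prop} : {θ : PBF X} → (∀ a ∈ θ.atoms, s a → s' a) → θ.Sat s → θ.Sat s'
  | tt, _, _ => trivial
  | ff, _, h => h
  | atom x, h, hs => h x rfl hs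
  | and _ _, h, hs => ⟨Sat.mono (fun a ha => h a (.inl ha)) hs.1,
      Sat.mono (fun a ha => h a (.inr ha)) hs.2⟩
  | or _ _, h, hs => hs.imp (Sat.mono fun a ha => h a (.inl ha))
      (Sat.mono fun a ha => h a (.inr ha))

/-- Renaming of atoms. -/
def map (f : X → Y) : PBF X → PBF Y
  | tt => tt
  | ff => ff
  | atom x => atom (f x)
  | and θ η => and (θ.map f) (η.map f)
  | or θ η => or (θ.map f) (η.map f)

theorem sat_map (f : X → Y) (s : Y → Prop) (θ : PBF X) : (θ.map f).Sat s ↔ θ.Sat (s ∘ f) := by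
  induction θ <;> simp_all [map, Sat]

theorem atoms_map (f : X → Y) (θ : PBF X) : (θ.map f).atoms = f '' θ.atoms := by
  induction θ <;> simp_all [map, atoms, Set.image_union]

theorem code_map (f : X → Y) (cX : X → ℕ) (cY : Y → ℕ) (θ : PBF X)
    (h : ∀ a ∈ θ.atoms, cY (f a) = cX a) : (θ.map f).code cY = θ.code cX := by
  induction θ <;> simp_all [map, atoms, code]

theorem subset_atoms_of_mem_dnf {θ : PBF X} {C : Set X} (hC : C ∈ θ.dnf) : C ⊆ θ.atoms := by
  induction θ generalizing C with
  | tt => simp_all [dnf]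
  | ff => simp_all [dnf]
  | atom x => simp_all [dnf, atoms]
  | and θ η h₁ h₂ =>
    obtain ⟨C₁, hC₁, C₂, hC₂, rfl⟩ := hC
    exact Set.union_subset_union (h₁ hC₁) (h₂ hC₂)
  | or θ η h₁ h₂ =>
    rcases hC with hC | hC
    · exact (h₁ hC).trans Set.subset_union_left
    · exact (h₂ hC).trans Set.subset_union_right

theorem subset_atoms_of_mem_cnf {θ : PBF X} {C : Set X} (hC : C ∈ θ.cnf) : C ⊆ θ.atoms := by
  induction θ generalizing C with
  | tt => simp_all [cnf]
  | ff => simp_all [cnf]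
  | atom x => simp_all [cnf, atoms]
  | or θ η h₁ h₂ =>
    obtain ⟨C₁, hC₁, C₂, hC₂, rfl⟩ := hC
    exact Set.union_subset_union (h₁ hC₁) (h₂ hC₂)
  | and θ η h₁ h₂ =>
    rcases hC with hC | hC
    · exact (h₁ hC).trans Set.subset_union_left
    · exact (h₂ hC).trans Set.subset_union_right

end PBF

/-! ### Unfoldings of finitely branching graphs -/

/-- `History R x₀ l`: the list `l` is a finite `R`-path from `x₀`, listed backwards. -/
inductive History {X : Type} (R : X → X → Prop) (x₀ : X) : List X → Prop
  | start : History R x₀ [x₀]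
  | step {x y : X} {l : List X} : History R x₀ (x :: l) → R x y → History R x₀ (y :: x :: l)

theorem History.ne_nil {X : Type} {R : X → X → Prop} {x₀ : X} {l : List X} (h : History R x₀ l) :
    l ≠ [] := by
  cases h <;> simp

/-- The tree unfolding of the graph `R` from `x₀`: its nodes are the finite paths from `x₀`, and
each is labelled with (the image under `f` of) its last vertex. -/
def unfold {X α : Type} (R : X → X → Prop) (hR : ∀ x, {y | R x y}.Finite) (f : X → α) (x₀ : X) :
    LabTree α where
  Node := {l : List X // History R x₀ l}
  root := ⟨[x₀], .start⟩
  succ u v := ∃ y, v.1 = y :: u.1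
  label u := f (u.1.head u.2.ne_nil)
  root_no_pred := by
    rintro ⟨l, hl⟩ ⟨y, hy⟩
    exact hl.ne_nil (List.cons.inj hy).2.symm
  pred_unique := by
    rintro ⟨l, hl⟩ ⟨l', hl'⟩ v ⟨y, hy⟩ ⟨y', hy'⟩
    exact Subtype.ext (List.cons.inj (hy.symm.trans hy')).2
  reachable := by
    rintro ⟨l, hl⟩
    induction hl with
    | start => exact .refl
    | step h _ ih => exact ih.tail ⟨_, rfl⟩
  finite_succ := by
    rintro ⟨l, hl⟩
    refine ((hR (l.head hl.ne_nil)).image (fun y => y :: l)).preimage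
      Subtype.val_injective.injOn |>.subset ?_
    rintro ⟨l', hl'⟩ ⟨y, rfl⟩
    refine ⟨y, ?_, rfl⟩
    cases hl' with
    | start => exact absurd rfl hl.ne_nil
    | step h hxy => exact hxy

section unfold

variable {X α : Type} {R : X → X → Prop} {hR : ∀ x, {y | R x y}.Finite} {f : X → α} {x₀ : X}

/-- The vertex of the graph at which a node of the unfolding ends. -/
def unfoldEnd (u : (unfold R hR f x₀).Node) : X := u.1.head u.2.ne_nil

theorem unfold_succ_end {u v : (unfold R hR f x₀).Node} (h : (unfold R hR f x₀).succ u v) :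
    R (unfoldEnd u) (unfoldEnd v) := by
  obtain ⟨l, hl⟩ := u
  obtain ⟨l', hl'⟩ := v
  obtain ⟨y, rfl⟩ := h
  cases hl' with
  | start => exact absurd rfl hl.ne_nil
  | step h hxy => exact hxy

theorem unfold_exists_succ (u : (unfold R hR f x₀).Node) {y : X} (h : R (unfoldEnd u) y) :
    ∃ v, (unfold R hR f x₀).succ u v ∧ unfoldEnd v = y := by
  obtain ⟨l, hl⟩ := u
  obtain ⟨x, l, rfl⟩ := List.exists_cons_of_ne_nil hl.ne_nil
  exact ⟨⟨y :: x :: l, .step hl h⟩, ⟨y, rfl⟩, rfl⟩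

theorem unfold_succ_injOn {u v v' : (unfold R hR f x₀).Node} (h : (unfold R hR f x₀).succ u v)
    (h' : (unfold R hR f x₀).succ u v') (e : unfoldEnd v = unfoldEnd v') : v = v' := by
  obtain ⟨l, hl⟩ := u
  obtain ⟨k, hk⟩ := v
  obtain ⟨k', hk'⟩ := v'
  obtain ⟨y, rfl⟩ := h
  obtain ⟨y', rfl⟩ := h'
  cases show y = y' from e
  rfl

end unfold

/-! ### Acceptance of linear automata by a valuation of the states -/

namespace Automaton

variable {I α : Type} {w : Bool}

/-- An atom holds at the node `v` of the input tree when `C` is the set of labels of the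
children. -/
def ChildSat {S : Type} (t : SigmaTree α) (v : t.Node) (C : Set (S × t.Node)) :
    Move w × S → Prop
  | (.dia k, q') => ∃ V : Finset t.Node, V.card = k ∧ ∀ v' ∈ V, t.succ v v' ∧ (q', v') ∈ C
  | (.box k, q') => {v' | t.succ v v' ∧ (q', v') ∉ C}.ncard < k
  | (.up, q') => ∃ v', t.succ v' v ∧ (q', v') ∈ C

/-- Runs matter only through the labels of the children of a node. -/
theorem atomSat_iff {n : ℕ} (t : SigmaTree α) (r : LabTree (Fin n × t.Node)) (u : r.Node)
    (a : Move w × Fin n) :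
    AtomSat t r u a ↔ ChildSat t (r.label u).2 {x | ∃ u', r.succ u u' ∧ r.label u' = x} a := by
  rcases a with ⟨_ | _ | _, q⟩
  · rfl
  · rfl
  · exact ⟨fun ⟨v', u', h, h'⟩ => ⟨v', h, u', h'⟩, fun ⟨v', h, u', h'⟩ => ⟨v', u', h, h'⟩⟩

/-- Atoms are monotone in the labels of the children, and only labels with the state of the atom and
a neighbour of `v` matter. -/
theorem ChildSat.mono {S : Type} {t : SigmaTree α} {v : t.Node} {C C' : Set (S × t.Node)}
    {a : Move w × S}
    (h : ∀ v', t.succ v v' ∨ t.succ v' v → (a.2, v') ∈ C → (a.2, v') ∈ C')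
    (ha : ChildSat t v C a) : ChildSat t v C' a := by
  rcases a with ⟨_ | k | _, q⟩
  · obtain ⟨V, hV, hv⟩ := ha
    exact ⟨V, hV, fun v' hv' => ⟨(hv v' hv').1, h v' (.inl (hv v' hv').1) (hv v' hv').2⟩⟩
  · refine lt_of_le_of_lt (Set.ncard_le_ncard ?_ ((t.finite_succ v).subset fun v' hv' => hv'.1)) ha
    exact fun v' hv' => ⟨hv'.1, fun hC => hv'.2 (h v' (.inl hv'.1) hC)⟩
  · obtain ⟨v', hv', hC⟩ := ha
    exact ⟨v', hv', h v' (.inr hv') hC⟩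

theorem childSat_dia_one {S : Type} {t : SigmaTree α} {v : t.Node} {C : Set (S × t.Node)}
    {q : S} : ChildSat (w := w) t v C (.dia 1, q) ↔ ∃ v', t.succ v v' ∧ (q, v') ∈ C := by
  constructor
  · rintro ⟨V, hV, h⟩
    obtain ⟨v', rfl⟩ := Finset.card_eq_one.1 hV
    exact ⟨v', h v' (by simp)⟩
  · rintro ⟨v', h⟩
    exact ⟨{v'}, by simp, by simpa using h⟩

theorem childSat_box_one {S : Type} {t : SigmaTree α} {v : t.Node} {C : Set (S × t.Node)}
    {q : S} : ChildSat (w := w) t v C (.box 1, q) ↔ ∀ v', t.succ v v' → (q, v') ∈ C := by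
  have hfin : {v' | t.succ v v' ∧ (q, v') ∉ C}.Finite :=
    (t.finite_succ v).subset fun v' hv' => hv'.1
  simp only [ChildSat, Nat.lt_one_iff, Set.ncard_eq_zero hfin, Set.eq_empty_iff_forall_notMem,
    Set.mem_ofPred_eq, not_and, not_not]

/-- A valuation `T` of the states of an automaton on a tree, certified by ranks: on accepting
states it is a post-fixpoint of the transition function and every failure is witnessed by failures
of smaller rank, and dually on the other states.  Thus, states below being given, `T` is the
greatest fixpoint on an accepting state and the least one on another state. -/
structure IsValuation (A : Automaton I w) (t : SigmaTree α) (obs : t.Node → I)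
    (T : Fin A.numStates → t.Node → Prop) (rank : Fin A.numStates → t.Node → ℕ) : Prop where
  of_sat : ∀ q v, q ∉ A.acc → (A.δ q (obs v)).Sat (ChildSat t v {x | T x.1 x.2}) → T q v
  sat : ∀ q v, q ∈ A.acc → T q v → (A.δ q (obs v)).Sat (ChildSat t v {x | T x.1 x.2})
  sat_rank : ∀ q v, q ∉ A.acc → T q v → (A.δ q (obs v)).Sat
    (ChildSat t v {x | T x.1 x.2 ∧ (x.1 = q → rank q x.2 < rank q v)})
  of_sat_rank : ∀ q v, q ∈ A.acc → (A.δ q (obs v)).Sat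
    (ChildSat t v {x | T x.1 x.2 ∨ (x.1 = q ∧ rank q v ≤ rank q x.2)}) → T q v

section valuation

variable {A : Automaton I w} {t : SigmaTree α} {obs : t.Node → I}
  {T : Fin A.numStates → t.Node → Prop} {rank : Fin A.numStates → t.Node → ℕ}
  {c : Fin A.numStates → ℕ}

theorem exists_infinite_path {β : Type} (r : LabTree β) (B : r.Node → Prop)
    (h : ∀ u, B u → ∃ u', r.succ u u' ∧ B u') {u : r.Node} (hu : B u) :
    ∃ π, r.IsPath π ∧ π 0 = u ∧ ∀ i, B (π i) := by
  choose g hg hB using h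
  let π : ℕ → {u // B u} := fun i => Nat.rec ⟨u, hu⟩ (fun _ x => ⟨g x.1 x.2, hB x.1 x.2⟩) i
  exact ⟨fun i => (π i).1, fun i => hg _ _, rfl, fun i => (π i).2⟩

/-- Along an accepting run, every label is true in the valuation. -/
theorem IsValuation.of_run (hT : A.IsValuation t obs T rank) (hord : A.Ordered c)
    (hc : Function.Injective c) {r : LabTree (Fin A.numStates × t.Node)}
    (hr : ∀ u, (A.δ (r.label u).1 (obs (r.label u).2)).Sat (AtomSat t r u))
    (hacc : A.IsAccepting t r) (u : r.Node) : T (r.label u).1 (r.label u).2 := by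
  obtain ⟨n, hn⟩ : ∃ n, n = c (r.label u).1 := ⟨_, rfl⟩
  -- Lower states are settled by induction; what remains is the behaviour within one state.
  induction n using Nat.strong_induction_on generalizing u with
  | _ n ih =>
  by_cases hq : (r.label u).1 ∈ A.acc
  · obtain ⟨k, hk⟩ : ∃ k, k = rank (r.label u).1 (r.label u).2 := ⟨_, rfl⟩
    induction k using Nat.strong_induction_on generalizing u with
    | _ k ihk =>
    refine hT.of_sat_rank _ _ hq ((hr u).mono fun a ha hs => ?_)
    refine ((atomSat_iff t r u a).1 hs).mono ?_
    rintro v' - ⟨u', hu', hl⟩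
    rcases lt_or_eq_of_le (hord _ _ a ha) with hlt | heq
    · left
      have := ih (c a.2) (hn ▸ hlt) u' (by rw [hl])
      rwa [hl] at this
    · have hqa := hc heq
      by_cases hle : rank (r.label u).1 (r.label u).2 ≤ rank (r.label u).1 v'
      · exact .inr ⟨hqa, hle⟩
      · left
        have := ihk (rank (r.label u).1 v') (hk ▸ not_le.1 hle) u' (by rw [hl, hqa, hn])
          (by rw [hl, hqa]; exact hq) (by rw [hl, hqa])
        rwa [hl] at this
  · by_contra hu
    -- A false label in a nonaccepting state is followed by another one in the same state.
    obtain ⟨π, hπ, -, hB⟩ := exists_infinite_path r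
      (fun u' => (r.label u').1 = (r.label u).1 ∧ ¬ T (r.label u').1 (r.label u').2)
      (fun u' hu' => by
        obtain ⟨he, hF⟩ := hu'
        by_contra hno
        push Not at hno
        refine hF (hT.of_sat _ _ (he ▸ hq) ((hr u').mono fun a ha hs => ?_))
        refine ((atomSat_iff t r u' a).1 hs).mono ?_
        rintro v' - ⟨u'', hu'', hl⟩
        rcases lt_or_eq_of_le (hord _ _ a ha) with hlt | heq
        · have := ih (c a.2) (hn ▸ he ▸ hlt) u'' (by rw [hl])
          rwa [hl] at this
        · have := hno u'' hu'' (by rw [hl, hc heq, he])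
          rwa [hl] at this) ⟨rfl, hu⟩
    obtain ⟨i, hi⟩ := (hacc π hπ).exists
    exact hq ((hB i).1 ▸ hi)

theorem finite_neighbours (t : SigmaTree α) (v : t.Node) :
    {v' | t.succ v v' ∨ t.succ v' v}.Finite :=
  (t.finite_succ v).union
    (Set.Subsingleton.finite fun _ h _ h' => t.pred_unique _ _ _ h h')

/-- A true label has an accepting run: the one which only visits true labels, and which decreases
the rank as long as it stays in a nonaccepting state. -/
theorem IsValuation.accepts (hT : A.IsValuation t obs T rank) (hord : A.Ordered c)
    (hc : Function.Injective c) (h : T A.init t.root) : A.Accepts t obs := by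
  let Y : Type := {x : Fin A.numStates × t.Node // T x.1 x.2}
  let R : Y → Y → Prop := fun x y =>
    c y.1.1 ≤ c x.1.1 ∧ (y.1.1 = x.1.1 → x.1.1 ∉ A.acc → rank x.1.1 y.1.2 < rank x.1.1 x.1.2) ∧
      (t.succ x.1.2 y.1.2 ∨ t.succ y.1.2 x.1.2)
  have hR : ∀ x, {y | R x y}.Finite := fun x =>
    Set.Finite.subset ((Set.finite_univ.prod (finite_neighbours t x.1.2)).preimage
      Subtype.val_injective.injOn) fun y hy => ⟨trivial, hy.2.2⟩
  refine ⟨unfold R hR Subtype.val ⟨(A.init, t.root), h⟩, ⟨rfl, fun u => ?_⟩, fun π hπ => ?_⟩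
  · change (A.δ (unfoldEnd u).1.1 (obs (unfoldEnd u).1.2)).Sat _
    set x := unfoldEnd u
    have key : ∀ a ∈ (A.δ x.1.1 (obs x.1.2)).atoms,
        ChildSat t x.1.2 {y | T y.1 y.2 ∧
          (y.1 = x.1.1 → x.1.1 ∉ A.acc → rank x.1.1 y.2 < rank x.1.1 x.1.2)} a →
        AtomSat t (unfold R hR Subtype.val ⟨(A.init, t.root), h⟩) u a := by
      intro a ha hs
      refine (atomSat_iff t _ u a).2 (hs.mono ?_)
      rintro v' hv' ⟨hTv, hrk⟩
      obtain ⟨u', hu', he⟩ := unfold_exists_succ u (y := ⟨(a.2, v'), hTv⟩)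
        ⟨hord _ _ a ha, hrk, hv'⟩
      exact ⟨u', hu', congrArg Subtype.val he⟩
    by_cases hq : x.1.1 ∈ A.acc
    · refine (hT.sat _ _ hq x.2).mono fun a ha hs => key a ha (hs.mono ?_)
      exact fun v' _ hv' => ⟨hv', fun _ hq' => absurd hq hq'⟩
    · refine (hT.sat_rank _ _ hq x.2).mono fun a ha hs => key a ha (hs.mono ?_)
      exact fun v' _ hv' => ⟨hv'.1, fun he _ => hv'.2 he⟩
  · let x : ℕ → Y := fun i => unfoldEnd (π i)
    have hx : ∀ i, R (x i) (x (i + 1)) := fun i => unfold_succ_end (hπ i)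
    -- The component eventually stabilizes.
    have hanti : Antitone fun i => c (x i).1.1 := antitone_nat_of_succ_le fun i => (hx i).1
    obtain ⟨N, hN⟩ : ∃ N, ∀ i, c (x N).1.1 ≤ c (x i).1.1 :=
      ⟨Function.argmin fun i => c (x i).1.1, fun i => Function.argmin_le (fun i => c (x i).1.1) i⟩
    have hconst : ∀ i, N ≤ i → (x i).1.1 = (x N).1.1 := fun i hi =>
      hc (le_antisymm (hanti hi) (hN i))
    have hqN : (x N).1.1 ∈ A.acc := by
      by_contra hq
      have hdec : ∀ i, rank (x N).1.1 (x (N + (i + 1))).1.2 < rank (x N).1.1 (x (N + i)).1.2 := by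
        intro i
        have e := hconst (N + i) (by omega)
        have e' := hconst (N + i + 1) (by omega)
        have := (hx (N + i)).2.1 (e'.trans e.symm) (e ▸ hq)
        rwa [e] at this
      exact not_strictAnti_of_wellFoundedLT (fun i => rank (x N).1.1 (x (N + i)).1.2)
        (strictAnti_nat_of_succ_lt hdec)
    refine Filter.Eventually.frequently (Filter.eventually_atTop.2 ⟨N, fun i hi => ?_⟩)
    exact (hconst i hi).symm ▸ hqN

/-- A linear automaton accepts exactly when its initial state is true at the root. -/
theorem IsValuation.accepts_iff (hT : A.IsValuation t obs T rank) (hord : A.Ordered c)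
    (hc : Function.Injective c) : A.Accepts t obs ↔ T A.init t.root := by
  refine ⟨fun ⟨r, ⟨hroot, hr⟩, hacc⟩ => ?_, hT.accepts hord hc⟩
  simpa [hroot] using hT.of_run hord hc hr hacc r.root

end valuation

/-- In a singleton component a clause of a disjunctive normal form has at most one atom of the
component. -/
theorem existential_of_injective {A : Automaton I w} {c : Fin A.numStates → ℕ}
    (hc : Function.Injective c) {i : ℕ}
    (h : ∀ q, c q = i → ∀ x, ∀ a ∈ (A.δ q x).atoms, c a.2 = i → a.1 = Move.dia 1) :
    A.Existential c i := by
  refine fun q hq x => ⟨h q hq x, fun C hC a ha b hb => ?_⟩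
  have hs := PBF.subset_atoms_of_mem_dnf hC
  exact Prod.ext ((h q hq x a (hs ha.1) ha.2).trans (h q hq x b (hs hb.1) hb.2).symm)
    (hc (ha.2.trans hb.2.symm))

theorem universal_of_injective {A : Automaton I w} {c : Fin A.numStates → ℕ}
    (hc : Function.Injective c) {i : ℕ}
    (h : ∀ q, c q = i → ∀ x, ∀ a ∈ (A.δ q x).atoms, c a.2 = i → a.1 = Move.box 1) :
    A.Universal c i := by
  refine fun q hq x => ⟨h q hq x, fun C hC a ha b hb => ?_⟩
  have hs := PBF.subset_atoms_of_mem_cnf hC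
  exact Prod.ext ((h q hq x a (hs ha.1) ha.2).trans (h q hq x b (hs hb.1) hb.2).symm)
    (hc (ha.2.trans hb.2.symm))

end Automaton

/-! ### Local semantics of the path operators -/

/-- `UntilIn R P Q n u`: some `R`-path of `n` steps from `u` ends in `Q` and is in `P` before. -/
def UntilIn {X : Type} (R : X → X → Prop) (P Q : X → Prop) : ℕ → X → Prop
  | 0, u => Q u
  | n + 1, u => P u ∧ ∃ v, R u v ∧ UntilIn R P Q n v

/-- Some finite `R`-path from `u` ends in `Q` and is in `P` before. -/
def Until {X : Type} (R : X → X → Prop) (P Q : X → Prop) (u : X) : Prop := ∃ n, UntilIn R P Q n u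

/-- The least length of a path witnessing `Until`, and `0` if there is none. -/
noncomputable def untilRank {X : Type} (R : X → X → Prop) (P Q : X → Prop) (u : X) : ℕ :=
  sInf {n | UntilIn R P Q n u}

section Until

variable {X : Type} {R : X → X → Prop} {P Q : X → Prop} {u : X}

theorem until_iff : Until R P Q u ↔ Q u ∨ P u ∧ ∃ v, R u v ∧ Until R P Q v := by
  constructor
  · rintro ⟨_ | n, h⟩
    · exact .inl h
    · exact .inr ⟨h.1, h.2.imp fun v hv => ⟨hv.1, n, hv.2⟩⟩
  · rintro (h | ⟨h, v, hv, n, hn⟩)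
    · exact ⟨0, h⟩
    · exact ⟨n + 1, h, v, hv, hn⟩

/-- A shortest witness of an until formula either ends at once or continues with a shorter one. -/
theorem until_rank (h : Until R P Q u) :
    Q u ∨ P u ∧ ∃ v, R u v ∧ Until R P Q v ∧ untilRank R P Q v < untilRank R P Q u := by
  have hmem : UntilIn R P Q (untilRank R P Q u) u := Nat.sInf_mem h
  rcases hn : untilRank R P Q u with _ | n
  · rw [hn] at hmem
    exact .inl hmem
  · rw [hn] at hmem
    obtain ⟨hP, v, hv, hv'⟩ := hmem
    exact .inr ⟨hP, v, hv, ⟨n, hv'⟩, Nat.lt_succ_of_le (Nat.sInf_le hv')⟩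

theorem Until.induction {C : X → Prop} (h : Until R P Q u) (h₀ : ∀ u, Q u → C u)
    (h₁ : ∀ u v, P u → R u v → C v → C u) : C u := by
  obtain ⟨n, hn⟩ := h
  induction n generalizing u with
  | zero => exact h₀ u hn
  | succ n ih =>
    obtain ⟨hP, v, hv, hv'⟩ := hn
    exact h₁ u v hP hv (ih hv')

end Until

section paths

variable {α : Type} (t : SigmaTree α)

theorem SigmaTree.exists_path (u : t.Node) : ∃ π, t.IsPath π ∧ π 0 = u := by
  obtain ⟨π, h, h0, -⟩ := Automaton.exists_infinite_path t.toLabTree (fun _ => True)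
    (fun u _ => (t.leafless u).imp fun _ h => ⟨h, trivial⟩) (u := u) trivial
  exact ⟨π, h, h0⟩

/-- Every infinite path from `u` is a suffix of an initial path. -/
theorem SigmaTree.exists_initialPath (u : t.Node) : ∃ i, ∀ ρ, t.IsPath ρ → ρ 0 = u →
    ∃ π, t.IsInitialPath π ∧ ∀ k, π (i + k) = ρ k := by
  induction t.reachable u with
  | refl => exact ⟨0, fun ρ h h0 => ⟨ρ, ⟨h0, h⟩, by simp⟩⟩
  | @tail b c _ hbc ih =>
    obtain ⟨i, hi⟩ := ih
    refine ⟨i + 1, fun ρ h h0 => ?_⟩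
    obtain ⟨π, hπ, hk⟩ := hi (fun k => Nat.casesOn k b ρ)
      (fun k => by cases k with
        | zero => simpa [h0] using hbc
        | succ k => exact h k) rfl
    exact ⟨π, hπ, fun k => by rw [add_assoc, add_comm 1]; exact hk (k + 1)⟩

end paths

namespace Formula

variable {m : ℕ} {t : SigmaTree (Letter m)} {φ ψ : Formula m} {u : t.Node}

/-- The tree has no leaves, so every successor lies on an initial path through `u`. -/
theorem sat_EX : (EX φ).Sat t u ↔ ∃ v, t.succ u v ∧ φ.Sat t v := by
  constructor
  · rintro ⟨π, i, hπ, rfl, h⟩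
    exact ⟨_, hπ.2 i, h⟩
  · rintro ⟨v, hv, h⟩
    obtain ⟨ρ, hρ, h0⟩ := t.exists_path v
    obtain ⟨i, hi⟩ := t.exists_initialPath u
    obtain ⟨π, hπ, hk⟩ := hi (fun k => Nat.casesOn k u ρ)
      (fun k => by cases k with
        | zero => simpa [h0] using hv
        | succ k => exact hρ k) rfl
    refine ⟨π, i, hπ, hk 0, ?_⟩
    rw [hk 1]
    simpa [h0] using h

theorem sat_EU : (EU φ ψ).Sat t u ↔ Until t.succ (φ.Sat t) (ψ.Sat t) u := by
  constructor
  · rintro ⟨π, i, hπ, rfl, j, hij, hj, h⟩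
    obtain ⟨n, rfl⟩ := Nat.exists_eq_add_of_le hij
    refine ⟨n, ?_⟩
    clear hij
    induction n generalizing i with
    | zero => exact hj
    | succ n ih =>
      refine ⟨h i le_rfl (by omega), _, hπ.2 i, ih (i + 1) ?_ fun k hk hk' => ?_⟩
      · rwa [add_right_comm, add_assoc]
      · exact h k (by omega) (by omega)
  · rintro ⟨n, hn⟩
    obtain ⟨ρ, hρ, h0, hn', hk'⟩ : ∃ ρ, t.IsPath ρ ∧ ρ 0 = u ∧ ψ.Sat t (ρ n) ∧
        ∀ k < n, φ.Sat t (ρ k) := by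
      induction n generalizing u with
      | zero =>
        obtain ⟨ρ, hρ, h0⟩ := t.exists_path u
        exact ⟨ρ, hρ, h0, h0 ▸ hn, by simp⟩
      | succ n ih =>
        obtain ⟨hφ, v, hv, hv'⟩ := hn
        obtain ⟨ρ, hρ, h0, hn', hk'⟩ := ih hv'
        refine ⟨fun k => Nat.casesOn k u ρ, fun k => ?_, rfl, hn', fun k hk => ?_⟩
        · cases k with
          | zero => simpa [h0] using hv
          | succ k => exact hρ k
        · cases k with
          | zero => exact hφ
          | succ k => exact hk' k (by omega)
    obtain ⟨i, hi⟩ := t.exists_initialPath u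
    obtain ⟨π, hπ, hk⟩ := hi ρ hρ h0
    refine ⟨π, i, hπ, (hk 0).trans h0, i + n, by omega, by rwa [hk], fun k h1 h2 => ?_⟩
    obtain ⟨l, rfl⟩ := Nat.exists_eq_add_of_le h1
    rw [hk]
    exact hk' l (by omega)

/-- The past of a node in a tree is unique, so the path quantifier has no influence here. -/
theorem sat_EY : (EY φ).Sat t u ↔ ∃ v, t.succ v u ∧ φ.Sat t v := by
  constructor
  · rintro ⟨π, i, hπ, rfl, hi, h⟩
    obtain ⟨j, rfl⟩ := Nat.exists_eq_add_of_lt hi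
    exact ⟨_, hπ.2 _, by simpa using h⟩
  · rintro ⟨v, hv, h⟩
    obtain ⟨ρ, hρ, h0⟩ := t.exists_path u
    obtain ⟨i, hi⟩ := t.exists_initialPath v
    obtain ⟨π, hπ, hk⟩ := hi (fun k => Nat.casesOn k v ρ)
      (fun k => by cases k with
        | zero => simpa [h0] using hv
        | succ k => exact hρ k) rfl
    exact ⟨π, i + 1, hπ, (hk 1).trans h0, by omega, by simpa using (hk 0).symm ▸ h⟩

end Formula

/-! ### Automata given by transition functions on natural numbers -/

namespace Automaton

variable {I α : Type} {w : Bool}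

/-- The automaton with states `0, …, N` whose transition formulae are written with natural numbers
for the states. -/
def ofNat (N : ℕ) (D : ℕ → I → PBF (Move w × ℕ)) (init : ℕ) (acc : ℕ → Bool) :
    Automaton I w where
  numStates := N + 1
  δ q x := (D q x).map (Prod.map id (Fin.ofNat (N + 1)))
  init := Fin.ofNat (N + 1) init
  acc := Finset.univ.filter fun q => acc q = true

variable {N : ℕ} {D : ℕ → I → PBF (Move w × ℕ)} {init : ℕ} {acc : ℕ → Bool}

theorem mem_atoms_ofNat (hD : ∀ q x, ∀ a ∈ (D q x).atoms, a.2 ≤ q) (q : Fin (N + 1)) (x : I)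
    {a : Move w × Fin (N + 1)} (ha : a ∈ ((ofNat N D init acc).δ q x).atoms) :
    (a.1, (a.2 : ℕ)) ∈ (D q x).atoms := by
  obtain ⟨b, hb, rfl⟩ := (PBF.atoms_map _ _).subset ha
  have : b.2 % (N + 1) = b.2 := Nat.mod_eq_of_lt ((hD q x b hb).trans_lt q.2)
  simpa [Fin.ofNat, this] using hb

theorem ordered_ofNat (hD : ∀ q x, ∀ a ∈ (D q x).atoms, a.2 ≤ q) :
    (ofNat N D init acc).Ordered Fin.val :=
  fun q x _ ha => hD q x _ (mem_atoms_ofNat hD q x ha)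

theorem sat_ofNat (hD : ∀ q x, ∀ a ∈ (D q x).atoms, a.2 ≤ q) (q : Fin (N + 1)) (x : I)
    (t : SigmaTree α) (v : t.Node) (C : Set (ℕ × t.Node)) :
    PBF.Sat (X := Move w × Fin (N + 1))
      (ChildSat t v {x : Fin (N + 1) × t.Node | ((x.1 : ℕ), x.2) ∈ C})
      ((ofNat N D init acc).δ q x) ↔
      (D q x).Sat (ChildSat t v C) := by
  have key : ∀ a ∈ (D q x).atoms, ((Fin.ofNat (N + 1) a.2 : Fin (N + 1)) : ℕ) = a.2 := fun a ha =>
    Nat.mod_eq_of_lt ((hD q x a ha).trans_lt q.2)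
  refine (PBF.sat_map _ _ _).trans ⟨PBF.Sat.mono ?_, PBF.Sat.mono ?_⟩
  all_goals
    rintro ⟨mv, k⟩ ha hs
    have hk : k % (N + 1) = k := key _ ha
    rcases mv with _ | _ | _ <;> simpa [ChildSat, hk] using hs

theorem mem_acc_ofNat (q : Fin (N + 1)) : q ∈ (ofNat N D init acc).acc ↔ acc q = true :=
  (Finset.mem_filter.trans (and_iff_right (Finset.mem_univ _)))

/-- Acceptance by an automaton on natural numbers, from a valuation of the natural numbers. -/
theorem ofNat_accepts_iff (hD : ∀ q x, ∀ a ∈ (D q x).atoms, a.2 ≤ q) (hinit : init < N + 1)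
    {t : SigmaTree α} {obs : t.Node → I} (T : ℕ → t.Node → Prop) (rank : ℕ → t.Node → ℕ)
    (of_sat : ∀ q v, acc q = false → (D q (obs v)).Sat (ChildSat t v {x | T x.1 x.2}) → T q v)
    (sat : ∀ q v, acc q = true → T q v → (D q (obs v)).Sat (ChildSat t v {x | T x.1 x.2}))
    (sat_rank : ∀ q v, acc q = false → T q v → (D q (obs v)).Sat
      (ChildSat t v {x | T x.1 x.2 ∧ (x.1 = q → rank q x.2 < rank q v)}))
    (of_sat_rank : ∀ q v, acc q = true → (D q (obs v)).Sat
      (ChildSat t v {x | T x.1 x.2 ∨ (x.1 = q ∧ rank q v ≤ rank q x.2)}) → T q v) :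
    (ofNat N D init acc).Accepts t obs ↔ T init t.root := by
  have hT : (ofNat N D init acc).IsValuation t obs (fun q => T q) (fun q => rank q) := by
    have hacc' : ∀ q : Fin (N + 1), q ∉ (ofNat N D init acc).acc → acc q = false := fun q hq =>
      Bool.eq_false_iff.2 fun h => hq ((mem_acc_ofNat q).2 h)
    constructor
    · intro q v hq h
      exact of_sat q v (hacc' q hq) ((sat_ofNat hD q _ t v {x | T x.1 x.2}).1 h)
    · intro q v hq h
      exact (sat_ofNat hD q _ t v {x | T x.1 x.2}).2 (sat q v ((mem_acc_ofNat q).1 hq) h)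
    · intro q v hq h
      have := (sat_ofNat (init := init) (acc := acc) hD q _ t v
        {x | T x.1 x.2 ∧ (x.1 = q → rank q x.2 < rank q v)}).2
        (sat_rank q v (hacc' q hq) h)
      exact this.mono fun a _ => ChildSat.mono fun v' _ h =>
        ⟨h.1, fun e => h.2 (congrArg Fin.val e)⟩
    · intro q v hq h
      refine of_sat_rank q v ((mem_acc_ofNat q).1 hq) ((sat_ofNat (init := init) (acc := acc)
        hD q _ t v {x | T x.1 x.2 ∨ (x.1 = q ∧ rank q v ≤ rank q x.2)}).1 ?_)
      exact h.mono fun a _ => ChildSat.mono fun v' _ h =>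
        h.imp id fun h => ⟨congrArg Fin.val h.1, h.2⟩
  refine (hT.accepts_iff (ordered_ofNat hD) Fin.val_injective).trans ?_
  have : ((ofNat N D init acc).init : ℕ) = init := Nat.mod_eq_of_lt hinit
  rw [this]

end Automaton

/-! ### From formulae to automata -/

/-- The dual pair of connectives: disjunction for `b = 0`, conjunction otherwise. -/
def PBF.junct {X : Type} (b : ℕ) (θ η : PBF X) : PBF X := if b = 0 then θ.or η else θ.and η

/-- The dual pair of moves: `◇ₙ` for `b = 0`, `□ₙ` otherwise. -/
def Move.graded (b n : ℕ) : Move false := if b = 0 then .dia n else .box n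

/-- The transition formulae of the automaton of a formula.  The state `2 * k` stands for the formula
with number `k`, and `2 * k + 1` for its negation; the set `p` is the letter read.  There are no
moves that stay at a node, so Boolean connectives are resolved within one transition.  Numbers that
are not codes of past-free formulae are read as codes all the same, and as falsity where this makes
no sense. -/
def formulaDelta (p : ℕ → Bool) (q : ℕ) : PBF (Move false × ℕ) :=
  if (q / 2).unpair.1 = 0 then
    if p (q / 2).unpair.2 = decide (q % 2 = 0) then .tt else .ff
  else if h1 : (q / 2).unpair.1 = 1 then
    formulaDelta p (2 * (q / 2).unpair.2 + (1 - q % 2))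
  else if h2 : (q / 2).unpair.1 = 2 then
    .junct (q % 2) (formulaDelta p (2 * (q / 2).unpair.2.unpair.1 + q % 2))
      (formulaDelta p (2 * (q / 2).unpair.2.unpair.2 + q % 2))
  else if (q / 2).unpair.1 = 3 then
    .atom (.graded (q % 2) (q / 2).unpair.2.unpair.1, 2 * (q / 2).unpair.2.unpair.2 + q % 2)
  else if (q / 2).unpair.1 = 4 then
    .atom (.graded (q % 2) 1, 2 * (q / 2).unpair.2 + q % 2)
  else if h5 : (q / 2).unpair.1 = 5 then
    .junct (q % 2) (formulaDelta p (2 * (q / 2).unpair.2.unpair.2 + q % 2))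
      (.junct (1 - q % 2) (formulaDelta p (2 * (q / 2).unpair.2.unpair.1 + q % 2))
        (.atom (.graded (q % 2) 1, q)))
  else if q % 2 = 0 then .ff else .tt
termination_by q
decreasing_by
  all_goals
    have := Nat.unpair_add_le (q / 2)
    have := Nat.unpair_add_le (q / 2).unpair.2
    omega

/-- The satisfaction relation of past-free formulae in terms of their numbers. -/
def CodeSat {m : ℕ} (t : SigmaTree (Letter m)) (k : ℕ) (v : t.Node) : Prop :=
  if k.unpair.1 = 0 then ∃ h : k.unpair.2 < m, ⟨k.unpair.2, h⟩ ∈ t.label v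
  else if _h1 : k.unpair.1 = 1 then ¬ CodeSat t k.unpair.2 v
  else if _h2 : k.unpair.1 = 2 then
    CodeSat t k.unpair.2.unpair.1 v ∨ CodeSat t k.unpair.2.unpair.2 v
  else if _h3 : k.unpair.1 = 3 then
    ∃ S : Finset t.Node, S.card = k.unpair.2.unpair.1 ∧
      ∀ v' ∈ S, t.succ v v' ∧ CodeSat t k.unpair.2.unpair.2 v'
  else if _h4 : k.unpair.1 = 4 then ∃ v', t.succ v v' ∧ CodeSat t k.unpair.2 v'
  else if _h5 : k.unpair.1 = 5 then
    Until t.succ (fun v' => CodeSat t k.unpair.2.unpair.1 v')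
      (fun v' => CodeSat t k.unpair.2.unpair.2 v') v
  else False
termination_by k
decreasing_by
  all_goals
    have := Nat.unpair_add_le k
    have := Nat.unpair_add_le k.unpair.2
    omega

theorem Formula.codeSat_iff {m : ℕ} (t : SigmaTree (Letter m)) {φ : Formula m} (h : φ.PastFree)
    (v : t.Node) : CodeSat t φ.code v ↔ φ.Sat t v := by
  induction φ generalizing v with
  | atom p => rw [CodeSat]; simp [code, Sat]
  | neg φ ih => rw [CodeSat]; simp [code, Sat, ih h]
  | or φ ψ ih₁ ih₂ => rw [CodeSat]; simp [code, Sat, ih₁ h.1, ih₂ h.2]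
  | count n φ ih => rw [CodeSat]; simp [code, Sat, ih h]
  | EX φ ih => rw [CodeSat, sat_EX]; simp [code, ih h]
  | EU φ ψ ih₁ ih₂ => rw [CodeSat, sat_EU]; simp [code, ih₁ h.1, ih₂ h.2]
  | EY φ => exact h.elim
  | ES φ ψ => exact h.elim

/-- The intended meaning of the states of `formulaDelta`. -/
def StateSat {m : ℕ} (t : SigmaTree (Letter m)) (q : ℕ) (v : t.Node) : Prop :=
  CodeSat t (q / 2) v ↔ q % 2 = 0

/-- The self-loop of a state `q` is `◇₁` or `□₁`, depending on the parity of `q`, and only codes of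
until formulae have one. -/
theorem formulaDelta_atoms (p : ℕ → Bool) (q : ℕ) : ∀ a ∈ (formulaDelta p q).atoms,
    a.2 ≤ q ∧ (a.2 = q → (q / 2).unpair.1 = 5 ∧ a.1 = Move.graded (q % 2) 1) := by
  induction q using Nat.strong_induction_on with
  | _ q ih =>
  intro a ha
  have e1 := Nat.unpair_add_le (q / 2)
  have e2 := Nat.unpair_add_le (q / 2).unpair.2
  have hj : ∀ b (θ η : PBF (Move false × ℕ)), (PBF.junct b θ η).atoms = θ.atoms ∪ η.atoms := by
    intro b θ η
    unfold PBF.junct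
    split_ifs <;> rfl
  rw [formulaDelta] at ha
  split_ifs at ha with h0 hp h1 h2 h3 h4 h5 h6
  · exact ha.elim
  · exact ha.elim
  · have := ih _ (by omega) a ha
    omega
  · rw [hj] at ha
    rcases ha with ha | ha
    · have := ih _ (by omega) a ha
      omega
    · have := ih _ (by omega) a ha
      omega
  · cases Set.mem_singleton_iff.1 ha
    dsimp only
    omega
  · cases Set.mem_singleton_iff.1 ha
    dsimp only
    omega
  · rw [hj, hj] at ha
    rcases ha with ha | ha | ha
    · have := ih _ (by omega) a ha
      omega
    · have := ih _ (by omega) a ha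
      omega
    · cases Set.mem_singleton_iff.1 ha
      exact ⟨le_rfl, fun _ => ⟨h5, rfl⟩⟩
  · exact ha.elim
  · exact ha.elim

theorem exists_finset_card_iff {X : Type} {F : Set X} (hF : F.Finite) (n : ℕ) :
    (∃ S : Finset X, S.card = n ∧ ∀ v ∈ S, v ∈ F) ↔ n ≤ F.ncard := by
  rw [Set.ncard_eq_toFinset_card F hF]
  constructor
  · rintro ⟨S, rfl, hS⟩
    exact Finset.card_le_card fun v hv => hF.mem_toFinset.2 (hS v hv)
  · intro h
    obtain ⟨S, hS, hc⟩ := Finset.exists_subset_card_eq h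
    exact ⟨S, hc, fun v hv => hF.mem_toFinset.1 (hS hv)⟩

theorem stateSat_two_mul_add {m : ℕ} {t : SigmaTree (Letter m)} {k b : ℕ} (hb : b < 2)
    {v : t.Node} : StateSat t (2 * k + b) v ↔ (CodeSat t k v ↔ b = 0) := by
  rw [StateSat, show (2 * k + b) / 2 = k by omega, show (2 * k + b) % 2 = b by omega]

theorem childSat_graded {m : ℕ} {t : SigmaTree (Letter m)} {v : t.Node} {n k b : ℕ}
    (hb : b < 2) :
    Automaton.ChildSat t v {x | StateSat t x.1 x.2} (Move.graded b n, 2 * k + b) ↔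
      ((∃ S : Finset t.Node, S.card = n ∧ ∀ v' ∈ S, t.succ v v' ∧ CodeSat t k v') ↔ b = 0) := by
  obtain rfl | rfl : b = 0 ∨ b = 1 := by omega
  · simp only [Move.graded, Automaton.ChildSat, Set.mem_ofPred_eq, stateSat_two_mul_add hb,
      if_true, iff_true]
  · have hfin : {v' | t.succ v v' ∧ CodeSat t k v'}.Finite :=
      (t.finite_succ v).subset fun v' hv' => hv'.1
    have := exists_finset_card_iff hfin n
    simp only [Set.mem_ofPred_eq] at this
    simp [Move.graded, Automaton.ChildSat, stateSat_two_mul_add hb, this]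

theorem sat_junct {X : Type} {s : X → Prop} {b : ℕ} {θ η : PBF X} {P Q : Prop} (hb : b < 2)
    (h₁ : θ.Sat s ↔ (P ↔ b = 0)) (h₂ : η.Sat s ↔ (Q ↔ b = 0)) :
    (PBF.junct b θ η).Sat s ↔ (P ∨ Q ↔ b = 0) := by
  obtain rfl | rfl : b = 0 ∨ b = 1 := by omega
  · simp_all [PBF.junct, PBF.Sat]
  · simp_all [PBF.junct, PBF.Sat]

theorem sat_junct_dual {X : Type} {s : X → Prop} {b : ℕ} {θ η : PBF X} {P Q : Prop} (hb : b < 2)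
    (h₁ : θ.Sat s ↔ (P ↔ b = 0)) (h₂ : η.Sat s ↔ (Q ↔ b = 0)) :
    (PBF.junct (1 - b) θ η).Sat s ↔ (P ∧ Q ↔ b = 0) := by
  obtain rfl | rfl : b = 0 ∨ b = 1 := by omega
  · simp_all [PBF.junct, PBF.Sat]
  · simp_all [PBF.junct, PBF.Sat]
    tauto

open Classical in
/-- A letter as a Boolean predicate on natural numbers. -/
noncomputable def letterTest {m : ℕ} (a : Letter m) (x : ℕ) : Bool :=
  decide (∃ h : x < m, ⟨x, h⟩ ∈ a)

section

variable {m : ℕ} (t : SigmaTree (Letter m))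

/-- The intended meaning of the states is a fixpoint of the transition function. -/
theorem sat_formulaDelta_iff (q : ℕ) (v : t.Node) :
    (formulaDelta (letterTest (t.label v)) q).Sat
      (Automaton.ChildSat t v {x | StateSat t x.1 x.2}) ↔ StateSat t q v := by
  induction q using Nat.strong_induction_on with
  | _ q ih =>
  have e1 := Nat.unpair_add_le (q / 2)
  have e2 := Nat.unpair_add_le (q / 2).unpair.2
  have hb : q % 2 < 2 := Nat.mod_lt _ (by omega)
  have hone : ∀ P : t.Node → Prop,
      (∃ S : Finset t.Node, S.card = 1 ∧ ∀ v' ∈ S, t.succ v v' ∧ P v') ↔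
        ∃ v', t.succ v v' ∧ P v' := fun P =>
    ⟨fun ⟨S, hS, h⟩ => by
      obtain ⟨v', rfl⟩ := Finset.card_eq_one.1 hS
      exact ⟨v', h v' (by simp)⟩, fun ⟨v', h⟩ => ⟨{v'}, by simp, by simpa using h⟩⟩
  rw [formulaDelta, StateSat, CodeSat]
  split_ifs with h0 hp h1 h2 h3 h4 h5 h6
  · by_cases hq : q % 2 = 0 <;> simp_all [letterTest, PBF.Sat]
  · by_cases hq : q % 2 = 0 <;> simp_all [letterTest, PBF.Sat]
  · rw [ih _ (by omega), stateSat_two_mul_add (by omega)]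
    obtain hq | hq : q % 2 = 0 ∨ q % 2 = 1 := by omega
    · simp [hq]
    · simp [hq]
  · refine sat_junct hb ?_ ?_
    · rw [ih _ (by omega), stateSat_two_mul_add hb]
    · rw [ih _ (by omega), stateSat_two_mul_add hb]
  · exact childSat_graded hb
  · exact (childSat_graded hb).trans (by rw [hone])
  · rw [until_iff]
    refine sat_junct hb ?_ (sat_junct_dual hb ?_ ?_)
    · rw [ih _ (by omega), stateSat_two_mul_add hb]
    · rw [ih _ (by omega), stateSat_two_mul_add hb]
    · have := childSat_graded (t := t) (v := v) (n := 1) (k := q / 2) hb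
      rw [hone, show 2 * (q / 2) + q % 2 = q by omega] at this
      refine this.trans ?_
      have hC : ∀ v', CodeSat t (q / 2) v' ↔
          Until t.succ (fun v' => CodeSat t (q / 2).unpair.2.unpair.1 v')
            (fun v' => CodeSat t (q / 2).unpair.2.unpair.2 v') v' := by
        intro v'
        conv_lhs => rw [CodeSat]
        simp [h5]
      simp only [hC]
  · simp [h6, PBF.Sat]
  · simp [h6, PBF.Sat]

/-- The automaton of the formula with number `k`. -/
noncomputable def codeHTA (m k : ℕ) : GTA m :=
  Automaton.ofNat (2 * k + 1) (fun q a => formulaDelta (letterTest a) q) (2 * k)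
    (fun q => decide (q % 2 = 1))

theorem codeHTA_isLinear (m k : ℕ) : (codeHTA m k).IsLinear := by
  have hD : ∀ (q : ℕ) (x : Letter m), ∀ a ∈ (formulaDelta (letterTest x) q).atoms, a.2 ≤ q :=
    fun q x a ha => (formulaDelta_atoms _ _ a ha).1
  refine ⟨Fin.val, ⟨Automaton.ordered_ofNat hD, ?_⟩, Fin.val_injective⟩
  rintro _ ⟨q, rfl⟩
  have key : ∀ q' : Fin (2 * k + 1 + 1), (q' : ℕ) = q → ∀ x, ∀ a ∈ ((codeHTA m k).δ q' x).atoms,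
      ((a.2 : Fin (2 * k + 1 + 1)) : ℕ) = q → a.1 = Move.graded ((q : ℕ) % 2) 1 := by
    intro q' hq' x a ha h
    have := formulaDelta_atoms _ _ _ (Automaton.mem_atoms_ofNat hD q' x ha)
    exact hq' ▸ (this.2 (h.trans hq'.symm)).2
  by_cases hq : (q : ℕ) % 2 = 0
  · refine .inr (.inl ⟨Automaton.existential_of_injective Fin.val_injective
      fun q' hq' x a ha h => ?_,
      fun q' hq' hacc => ?_⟩)
    · simpa [Move.graded, hq] using key q' hq' x a ha h
    · have := (Automaton.mem_acc_ofNat _).1 hacc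
      simp only [decide_eq_true_eq] at this
      omega
  · refine .inr (.inr ⟨Automaton.universal_of_injective Fin.val_injective fun q' hq' x a ha h => ?_,
      fun q' hq' => (Automaton.mem_acc_ofNat _).2 ?_⟩)
    · simpa [Move.graded, hq] using key q' hq' x a ha h
    · simp only [decide_eq_true_eq]
      omega

theorem codeHTA_accepts_iff (k : ℕ) : (codeHTA m k).Accepts t t.label ↔ CodeSat t k t.root := by
  let P : ℕ → t.Node → Prop := fun q v' => CodeSat t (q / 2).unpair.2.unpair.1 v'
  let Q : ℕ → t.Node → Prop := fun q v' => CodeSat t (q / 2).unpair.2.unpair.2 v'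
  have hU : ∀ q, (q / 2).unpair.1 = 5 → ∀ v',
      CodeSat t (q / 2) v' ↔ Until t.succ (P q) (Q q) v' := by
    intro q h5 v'
    conv_lhs => rw [CodeSat]
    simp [h5, P, Q]
  -- A formula other than an until formula does not loop, so the rank plays no role.
  have hloop : ∀ q v, (q / 2).unpair.1 ≠ 5 → ∀ C : Set (ℕ × t.Node),
      (∀ x : ℕ × t.Node, x.1 < q → (x ∈ C ↔ StateSat t x.1 x.2)) →
      ((formulaDelta (letterTest (t.label v)) q).Sat (Automaton.ChildSat t v C) ↔
        StateSat t q v) := by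
    intro q v h5 C hC
    have hlt : ∀ a ∈ (formulaDelta (letterTest (t.label v)) q).atoms, a.2 < q := fun a ha =>
      lt_of_le_of_ne (formulaDelta_atoms _ _ a ha).1
        fun h => h5 ((formulaDelta_atoms _ _ a ha).2 h).1
    rw [← sat_formulaDelta_iff]
    exact ⟨PBF.Sat.mono fun a ha => Automaton.ChildSat.mono fun v' _ => (hC (a.2, v') (hlt a ha)).1,
      PBF.Sat.mono fun a ha => Automaton.ChildSat.mono fun v' _ => (hC (a.2, v') (hlt a ha)).2⟩
  have hsub : ∀ q q' v, q' < q → ∀ C : Set (ℕ × t.Node),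
      (∀ x : ℕ × t.Node, x.1 < q → (x ∈ C ↔ StateSat t x.1 x.2)) →
      ((formulaDelta (letterTest (t.label v)) q').Sat (Automaton.ChildSat t v C) ↔
        StateSat t q' v) := by
    intro q q' v hq C hC
    have hlt : ∀ a ∈ (formulaDelta (letterTest (t.label v)) q').atoms, a.2 < q := fun a ha =>
      (formulaDelta_atoms _ _ a ha).1.trans_lt hq
    rw [← sat_formulaDelta_iff]
    exact ⟨PBF.Sat.mono fun a ha => Automaton.ChildSat.mono fun v' _ => (hC (a.2, v') (hlt a ha)).1,
      PBF.Sat.mono fun a ha => Automaton.ChildSat.mono fun v' _ => (hC (a.2, v') (hlt a ha)).2⟩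
  refine (Automaton.ofNat_accepts_iff (fun q x a ha => (formulaDelta_atoms _ _ a ha).1)
    (by omega) (StateSat t) (fun q => untilRank t.succ (P q) (Q q))
    (fun q v _ => (sat_formulaDelta_iff t q v).1) (fun q v _ => (sat_formulaDelta_iff t q v).2)
    ?_ ?_).trans ?_
  · intro q v hq h
    have hq0 : q % 2 = 0 := by simpa using hq
    have e1 := Nat.unpair_add_le (q / 2)
    have e2 := Nat.unpair_add_le (q / 2).unpair.2
    have hC : ∀ x : ℕ × t.Node, x.1 < q → ((x ∈ {x : ℕ × t.Node | StateSat t x.1 x.2 ∧ (x.1 = q →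
        untilRank t.succ (P q) (Q q) x.2 < untilRank t.succ (P q) (Q q) v)}) ↔
        StateSat t x.1 x.2) := fun x hx =>
      ⟨fun h => h.1, fun h => ⟨h, fun he => absurd he hx.ne⟩⟩
    by_cases h5 : (q / 2).unpair.1 = 5
    · have hv : Until t.succ (P q) (Q q) v := (hU q h5 v).1 (h.2 hq0)
      rw [formulaDelta]
      simp only [h5, hq0, PBF.junct]
      simp only [show ¬ (5 = 0) by omega, show ¬ (5 = 1) by omega, show ¬ (5 = 2) by omega,
        show ¬ (5 = 3) by omega, show ¬ (5 = 4) by omega, if_true, if_false, dite_true, dite_false,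
        PBF.Sat]
      rcases until_rank hv with hQ | ⟨hP, v', hv', hu, hr⟩
      · left
        rw [hsub q _ v (by omega) _ hC, stateSat_two_mul_add (by omega)]
        simpa [Q] using hQ
      · right
        constructor
        · rw [hsub q _ v (by omega) _ hC, stateSat_two_mul_add (by omega)]
          simpa [P] using hP
        · refine Automaton.childSat_dia_one.2 ⟨v', hv', ?_, fun _ => hr⟩
          exact iff_of_true ((hU q h5 v').2 hu) hq0
    · exact (hloop q v h5 _ hC).2 h
  · intro q v hq h
    have hq1 : q % 2 = 1 := by simpa using hq
    have e1 := Nat.unpair_add_le (q / 2)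
    have e2 := Nat.unpair_add_le (q / 2).unpair.2
    have hC : ∀ x : ℕ × t.Node, x.1 < q → ((x ∈ {x : ℕ × t.Node | StateSat t x.1 x.2 ∨ (x.1 = q ∧
        untilRank t.succ (P q) (Q q) v ≤ untilRank t.succ (P q) (Q q) x.2)}) ↔
        StateSat t x.1 x.2) := fun x hx =>
      ⟨fun h => h.resolve_right fun h => hx.ne h.1, fun h => .inl h⟩
    by_cases h5 : (q / 2).unpair.1 = 5
    · refine iff_of_false (fun hv => ?_) (by omega)
      rw [hU q h5] at hv
      rw [formulaDelta] at h
      simp only [h5, hq1, PBF.junct] at h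
      simp only [show ¬ (5 = 0) by omega, show ¬ (5 = 1) by omega, show ¬ (5 = 2) by omega,
        show ¬ (5 = 3) by omega, show ¬ (5 = 4) by omega, show ¬ (1 = 0) by omega, if_true,
        if_false, dite_true, dite_false, show 1 - 1 = 0 by omega, PBF.Sat] at h
      obtain ⟨h₁, h₂⟩ := h
      rw [hsub q _ v (by omega) _ hC, stateSat_two_mul_add (by omega)] at h₁
      rcases until_rank hv with hQ | ⟨hP, v', hv', hu, hr⟩
      · simp [Q] at hQ
        simp [hQ] at h₁
      · rcases h₂ with h₂ | h₂
        · rw [hsub q _ v (by omega) _ hC, stateSat_two_mul_add (by omega)] at h₂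
          simp [P] at hP
          simp [hP] at h₂
        · rcases Automaton.childSat_box_one.1 h₂ v' hv' with hs | ⟨-, hle⟩
          · have := hs.1 ((hU q h5 v').2 hu)
            omega
          · exact absurd hr (not_lt.2 hle)
    · exact (hloop q v h5 _ hC).1 h
  · rw [show 2 * k = 2 * k + 0 from rfl, stateSat_two_mul_add (by omega)]
    simp

end

/-! ### Computability of the automaton of a formula -/

/-- The number of an atom in the Gödel numbering of transition formulae. -/
def atomCode {w : Bool} (a : Move w × ℕ) : ℕ := Nat.pair a.1.code a.2

theorem Automaton.code_δ_ofNat {I : Type} {w : Bool} {N : ℕ} {D : ℕ → I → PBF (Move w × ℕ)}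
    {init : ℕ} {acc : ℕ → Bool} (hD : ∀ q x, ∀ a ∈ (D q x).atoms, a.2 ≤ q) (q : Fin (N + 1))
    (x : I) : ((ofNat N D init acc).δ q x).code (fun a => Nat.pair a.1.code (a.2 : ℕ)) =
      (D q x).code atomCode := by
  refine PBF.code_map _ _ _ _ fun a ha => ?_
  have : a.2 % (N + 1) = a.2 := Nat.mod_eq_of_lt ((hD q x a ha).trans_lt q.2)
  exact congrArg (Nat.pair a.1.code) this

theorem ofFn_eq_map_range {β : Type} {n : ℕ} (f : ℕ → β) :
    List.ofFn (fun q : Fin n => f q) = (List.range n).map f :=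
  List.ext_getElem (by simp) (by
    intros
    simp only [List.getElem_ofFn, List.getElem_map, List.getElem_range])

theorem Automaton.code_ofNat {I : Type} {w : Bool} {N : ℕ} {D : ℕ → I → PBF (Move w × ℕ)}
    {init : ℕ} {acc : ℕ → Bool} (hD : ∀ q x, ∀ a ∈ (D q x).atoms, a.2 ≤ q) (hinit : init < N + 1)
    (xs : List I) : (ofNat N D init acc).code xs = Encodable.encode
      (init, (List.range (N + 1)).map (fun q => xs.map fun x => (D q x).code atomCode),
        (List.range (N + 1)).map acc) := by
  have h1 : ((ofNat N D init acc).init : ℕ) = init := Nat.mod_eq_of_lt hinit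
  have h2 : ∀ q : Fin (ofNat N D init acc).numStates,
      decide (q ∈ (ofNat N D init acc).acc) = acc q := fun q => by
    rw [Bool.eq_iff_iff, decide_eq_true_eq]
    exact mem_acc_ofNat q
  unfold code
  simp only [h1, h2]
  congr 2
  refine congrArg₂ Prod.mk ?_ (ofFn_eq_map_range acc)
  refine Eq.trans (congrArg List.ofFn (funext fun q => ?_)) (ofFn_eq_map_range _)
  exact List.map_congr_left fun x _ => code_δ_ofNat hD q x

/-- The letter with number `s` contains `x` when the bit `x` of `s` is set.  This holds for `x ≥ m`,
too, since `s` has only `m` bits. -/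
theorem letterTest_letters {m s : ℕ} (hs : s < 2 ^ m) :
    letterTest (Finset.univ.filter fun i : Fin m => s.testBit i = true) = s.testBit := by
  funext x
  rw [Bool.eq_iff_iff]
  simp only [letterTest, decide_eq_true_eq, Finset.mem_filter, Finset.mem_univ, true_and]
  refine ⟨fun ⟨_, h⟩ => h, fun h => ⟨?_, h⟩⟩
  by_contra hx
  rw [Nat.testBit_eq_false_of_lt (hs.trans_le (Nat.pow_le_pow_right (by omega) (not_lt.1 hx)))] at h
  exact Bool.noConfusion h

/-- The number of the transition formula of the state `L.length`, computed from the list `L` of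
those of the smaller states; `s` is the number of the letter.  The cases are those of
`formulaDelta`. -/
def deltaCodeStep (s : ℕ) (L : List ℕ) : ℕ :=
  let q := L.length
  let k := q / 2
  let b := q % 2
  let x := k.unpair.2
  if k.unpair.1 = 0 then (if s.testBit x = decide (b = 0) then Nat.pair 0 0 else Nat.pair 0 1)
  else if k.unpair.1 = 1 then L.getD (2 * x + (1 - b)) 0
  else if k.unpair.1 = 2 then
    Nat.pair (3 - b) (Nat.pair (L.getD (2 * x.unpair.1 + b) 0) (L.getD (2 * x.unpair.2 + b) 0))
  else if k.unpair.1 = 3 then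
    Nat.pair 1 (Nat.pair (Nat.pair b x.unpair.1) (2 * x.unpair.2 + b))
  else if k.unpair.1 = 4 then Nat.pair 1 (Nat.pair (Nat.pair b 1) (2 * x + b))
  else if k.unpair.1 = 5 then
    Nat.pair (3 - b) (Nat.pair (L.getD (2 * x.unpair.2 + b) 0)
      (Nat.pair (2 + b) (Nat.pair (L.getD (2 * x.unpair.1 + b) 0)
        (Nat.pair 1 (Nat.pair (Nat.pair b 1) q)))))
  else if b = 0 then Nat.pair 0 1 else Nat.pair 0 0

theorem deltaCodeStep_eq (s q : ℕ) : deltaCodeStep s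
    ((List.range q).map fun q => (formulaDelta s.testBit q).code atomCode) =
      (formulaDelta s.testBit q).code atomCode := by
  have e1 := Nat.unpair_add_le (q / 2)
  have e2 := Nat.unpair_add_le (q / 2).unpair.2
  have hb : q % 2 < 2 := Nat.mod_lt _ (by omega)
  have hL : ∀ i < q, ((List.range q).map fun q => (formulaDelta s.testBit q).code atomCode).getD i 0
      = (formulaDelta s.testBit i).code atomCode := fun i hi => by
    simp [List.getD, hi]
  have hj : ∀ b < 2, ∀ θ η : PBF (Move false × ℕ), (PBF.junct b θ η).code atomCode =
      Nat.pair (3 - b) (Nat.pair (θ.code atomCode) (η.code atomCode)) := by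
    intro b hb θ η
    obtain rfl | rfl : b = 0 ∨ b = 1 := by omega
    all_goals rfl
  have ha : ∀ n k, (PBF.atom (Move.graded (q % 2) n, k)).code atomCode =
      Nat.pair 1 (Nat.pair (Nat.pair (q % 2) n) k) := by
    intro n k
    obtain hq | hq : q % 2 = 0 ∨ q % 2 = 1 := by omega
    all_goals rw [hq]; rfl
  conv_rhs => rw [formulaDelta]
  simp only [deltaCodeStep, List.length_map, List.length_range]
  split_ifs
  · rfl
  · rfl
  · rw [hL _ (by omega)]
  · rw [hj _ hb, hL _ (by omega), hL _ (by omega)]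
  · rw [ha]
  · rw [ha]
  · rw [hj _ hb, hj _ (by omega), ha, hL _ (by omega), hL _ (by omega),
      show 3 - (1 - q % 2) = 2 + q % 2 by omega]
  · rfl
  · rfl

open Primrec

theorem primrec_nat_pow : Primrec₂ ((· ^ ·) : ℕ → ℕ → ℕ) := Primrec₂.unpaired'.1 Nat.Primrec.pow

theorem primrec_testBit : Primrec₂ Nat.testBit := by
  have h : Primrec₂ fun a b : ℕ => decide (a / 2 ^ b % 2 = 1) :=
    PrimrecRel.decide (PrimrecRel.comp₂ Primrec.eq
      (nat_mod.comp₂ (nat_div.comp₂ Primrec₂.left (primrec_nat_pow.comp₂ (Primrec₂.const 2)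
        Primrec₂.right)) (Primrec₂.const 2)) (Primrec₂.const 1))
  exact h.of_eq fun a b => Nat.testBit_eq_decide_div_mod_eq.symm

theorem primrec_deltaCodeStep : Primrec₂ deltaCodeStep := by
  have hL : Primrec fun p : ℕ × List ℕ => p.2 := snd
  have hq : Primrec fun p : ℕ × List ℕ => p.2.length := list_length.comp snd
  have hk : Primrec fun p : ℕ × List ℕ => p.2.length / 2 := nat_div.comp hq (const 2)
  have hb : Primrec fun p : ℕ × List ℕ => p.2.length % 2 := nat_mod.comp hq (const 2)
  have htag : Primrec fun p : ℕ × List ℕ => (p.2.length / 2).unpair.1 := fst.comp (unpair.comp hk)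
  have hx : Primrec fun p : ℕ × List ℕ => (p.2.length / 2).unpair.2 := snd.comp (unpair.comp hk)
  have hx1 : Primrec fun p : ℕ × List ℕ => (p.2.length / 2).unpair.2.unpair.1 :=
    fst.comp (unpair.comp hx)
  have hx2 : Primrec fun p : ℕ × List ℕ => (p.2.length / 2).unpair.2.unpair.2 :=
    snd.comp (unpair.comp hx)
  have htwo : ∀ {f g : ℕ × List ℕ → ℕ}, Primrec f → Primrec g →
      Primrec fun p => 2 * f p + g p := fun hf hg => nat_add.comp (nat_mul.comp (const 2) hf) hg
  have hget : ∀ {f : ℕ × List ℕ → ℕ}, Primrec f → Primrec fun p : ℕ × List ℕ => p.2.getD (f p) 0 :=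
    fun hf => (list_getD 0).comp hL hf
  have hpair : ∀ {f g : ℕ × List ℕ → ℕ}, Primrec f → Primrec g →
      Primrec fun p => Nat.pair (f p) (g p) := fun hf hg => Primrec₂.natPair.comp hf hg
  have heq : ∀ {f : ℕ × List ℕ → ℕ} (n : ℕ), Primrec f → PrimrecPred fun p => f p = n :=
    fun n hf => Primrec.eq.comp hf (const n)
  have hnb : ∀ n : ℕ, Primrec fun p : ℕ × List ℕ => n - p.2.length % 2 := fun n =>
    nat_sub.comp (const n) hb
  have htest : Primrec fun p : ℕ × List ℕ => p.1.testBit (p.2.length / 2).unpair.2 :=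
    primrec_testBit.comp fst hx
  have h0 : PrimrecPred fun p : ℕ × List ℕ =>
      p.1.testBit (p.2.length / 2).unpair.2 = decide (p.2.length % 2 = 0) :=
    Primrec.eq.comp htest (PrimrecPred.decide (heq 0 hb))
  unfold deltaCodeStep
  exact ite (heq 0 htag) (ite h0 (const _) (const _)) <|
    ite (heq 1 htag) (hget (htwo hx (hnb 1))) <|
    ite (heq 2 htag) (hpair (hnb 3) (hpair (hget (htwo hx1 hb)) (hget (htwo hx2 hb)))) <|
    ite (heq 3 htag) (hpair (const 1) (hpair (hpair hb hx1) (htwo hx2 hb))) <|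
    ite (heq 4 htag) (hpair (const 1) (hpair (hpair hb (const 1)) (htwo hx hb))) <|
    ite (heq 5 htag) (hpair (hnb 3) (hpair (hget (htwo hx2 hb))
      (hpair (nat_add.comp (const 2) hb) (hpair (hget (htwo hx1 hb))
        (hpair (const 1) (hpair (hpair hb (const 1)) hq)))))) <|
    ite (heq 0 hb) (const _) (const _)

theorem primrec_deltaCode :
    Primrec₂ fun s q : ℕ => (formulaDelta s.testBit q).code atomCode :=
  nat_strong_rec _ (option_some.comp₂ primrec_deltaCodeStep) fun s q =>
    congrArg some (deltaCodeStep_eq s q)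

theorem primrec_codeHTA_code (m : ℕ) : Primrec fun k => (codeHTA m k).code (letters m) := by
  have h : ∀ k, (codeHTA m k).code (letters m) = Encodable.encode (2 * k,
      (List.range (2 * k + 1 + 1)).map (fun q => (List.range (2 ^ m)).map fun s =>
        (formulaDelta s.testBit q).code atomCode),
      (List.range (2 * k + 1 + 1)).map fun q => decide (q % 2 = 1)) := by
    intro k
    refine (Automaton.code_ofNat (fun q x a ha => (formulaDelta_atoms _ _ a ha).1) (by omega)
      (letters m)).trans ?_
    have hrow : ∀ q, ((letters m).map fun x => (formulaDelta (letterTest x) q).code atomCode) =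
        (List.range (2 ^ m)).map fun s => (formulaDelta s.testBit q).code atomCode := by
      intro q
      rw [letters, List.map_map]
      refine List.map_congr_left fun s hs => ?_
      simp only [Function.comp_apply]
      rw [letterTest_letters (List.mem_range.1 hs)]
    simp only [hrow]
  have hrange : Primrec fun k : ℕ => List.range (2 * k + 1 + 1) :=
    list_range.comp (Primrec.succ.comp nat_double_succ)
  refine (Primrec.encode.comp (Primrec.pair nat_double (Primrec.pair
    (list_map hrange ?_) (list_map hrange ?_)))).of_eq fun k => (h k).symm
  · exact list_map (const _) (primrec_deltaCode.comp snd (snd.comp fst)).to₂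
  · exact PrimrecPred.decide (Primrec.eq.comp (nat_mod.comp snd (const 2)) (const 1))

theorem polCTL_translatesTo_linearHTA (m : ℕ) : (polCTL m).TranslatesTo (linearHTA m) := by
  refine ⟨_, (primrec_codeHTA_code m).to_comp, fun φ => ⟨⟨codeHTA m φ.1.code,
    codeHTA_isLinear m _⟩, rfl, ?_⟩⟩
  ext t
  exact (codeHTA_accepts_iff t _).trans (Formula.codeSat_iff t φ.2 t.root)

/-! ### From linear automata to formulae -/

namespace Formula

variable {m : ℕ}

/-- Truth.  An atom is needed to write it, hence the assumption `0 < m`. -/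
def tt (hm : 0 < m) : Formula m := count 0 (atom ⟨0, hm⟩)

/-- Falsity. -/
def ff (hm : 0 < m) : Formula m := neg (tt hm)

/-- Conjunction, by De Morgan. -/
def and (φ ψ : Formula m) : Formula m := neg (or (neg φ) (neg ψ))

variable {t : SigmaTree (Letter m)} {v : t.Node} {hm : 0 < m}

theorem sat_tt : (tt hm).Sat t v := ⟨∅, rfl, by simp⟩

theorem sat_ff : ¬ (ff hm).Sat t v := fun h => h sat_tt

theorem sat_and {φ ψ : Formula m} : (and φ ψ).Sat t v ↔ φ.Sat t v ∧ ψ.Sat t v := by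
  simp only [and, Sat, not_or, not_not]

/-- The formula saying that the label of the node is `a`. -/
def letter (hm : 0 < m) (a : Letter m) : Formula m :=
  (List.finRange m).foldr (fun p φ => and (if p ∈ a then atom p else neg (atom p)) φ) (tt hm)

theorem sat_letter {a : Letter m} : (letter hm a).Sat t v ↔ t.label v = a := by
  have key : ∀ l : List (Fin m),
      (l.foldr (fun p φ => and (if p ∈ a then atom p else neg (atom p)) φ) (tt hm)).Sat t v ↔
        ∀ p ∈ l, (p ∈ t.label v ↔ p ∈ a) := by
    intro l
    induction l with
    | nil => simp [sat_tt]
    | cons p l ih =>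
      rw [List.foldr_cons, sat_and, ih, List.forall_mem_cons]
      refine and_congr_left fun _ => ?_
      split_ifs with h <;> simp [Sat, h]
  rw [letter, key]
  simp [Finset.ext_iff]

theorem pastFree_letter (a : Letter m) : (letter hm a).PastFree := by
  unfold letter
  induction List.finRange m with
  | nil => trivial
  | cons p l ih =>
    rw [List.foldr_cons]
    refine ⟨?_, ih⟩
    split_ifs <;> trivial

end Formula

theorem mem_letters {m : ℕ} (a : Letter m) : a ∈ letters m := by
  refine List.mem_map.2 ⟨Nat.ofBits fun i : Fin m => decide (i ∈ a),
    List.mem_range.2 (Nat.ofBits_lt_two_pow _), ?_⟩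
  ext i
  simp

section

open Formula

variable {m : ℕ} (hm : 0 < m)

/-- The formula for a move, given the formula for the target state. -/
def moveFormula (φ : Formula m) : Move false → Formula m
  | .dia k => .count k φ
  | .box k => .neg (.count k (.neg φ))

/-- A transition formula as a formula, given formulae `Φ` for the states, where the atoms of the
state `q` have truth value `b`. -/
def transFormula {n : ℕ} (q : Fin n) (b : Bool) (Φ : Fin n → Formula m) :
    PBF (Move false × Fin n) → Formula m
  | .tt => tt hm
  | .ff => ff hm
  | .atom a => if a.2 = q then (if b then tt hm else ff hm) else moveFormula (Φ a.2) a.1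
  | .and θ η => (transFormula q b Φ θ).and (transFormula q b Φ η)
  | .or θ η => (transFormula q b Φ θ).or (transFormula q b Φ η)

theorem sat_transFormula {n : ℕ} (q : Fin n) (b : Bool) (Φ : Fin n → Formula m)
    (t : SigmaTree (Letter m)) (v : t.Node) (θ : PBF (Move false × Fin n)) :
    (transFormula hm q b Φ θ).Sat t v ↔ θ.Sat fun a =>
      if a.2 = q then b = true else Automaton.ChildSat t v {x | (Φ x.1).Sat t x.2} a := by
  induction θ with
  | tt => exact iff_of_true sat_tt trivial
  | ff => exact iff_of_false sat_ff id
  | and θ η h₁ h₂ => exact sat_and.trans (and_congr h₁ h₂)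
  | or θ η h₁ h₂ => exact or_congr h₁ h₂
  | atom a =>
    simp only [transFormula, PBF.Sat]
    split_ifs with h hb
    · simp [sat_tt, hb]
    · simp [sat_ff, hb]
    · obtain ⟨_ | k, q'⟩ := a
      · rfl
      · have hfin : {v' | t.succ v v' ∧ ¬ (Φ q').Sat t v'}.Finite :=
          (t.finite_succ v).subset fun v' hv' => hv'.1
        exact (not_congr (exists_finset_card_iff hfin k)).trans not_le

variable (A : GTA m)

/-- The transition condition of the state `q` as a formula. -/
def rowFormula (q : Fin A.numStates) (b : Bool) (Φ : Fin A.numStates → Formula m) : Formula m :=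
  (letters m).foldr (fun a φ => .or (.and (letter hm a) (transFormula hm q b Φ (A.δ q a))) φ)
    (ff hm)

theorem sat_rowFormula (q : Fin A.numStates) (b : Bool) (Φ : Fin A.numStates → Formula m)
    (t : SigmaTree (Letter m)) (v : t.Node) : (rowFormula hm A q b Φ).Sat t v ↔
    (A.δ q (t.label v)).Sat fun a =>
      if a.2 = q then b = true else Automaton.ChildSat t v {x | (Φ x.1).Sat t x.2} a := by
  have key : ∀ l : List (Letter m),
      (l.foldr (fun a φ => Formula.or (.and (letter hm a) (transFormula hm q b Φ (A.δ q a))) φ)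
        (ff hm)).Sat t v ↔ ∃ a ∈ l, t.label v = a ∧ (transFormula hm q b Φ (A.δ q a)).Sat t v := by
    intro l
    induction l with
    | nil => simp [sat_ff]
    | cons a l ih =>
      rw [List.foldr_cons, Sat, ih, sat_and, sat_letter]
      simp only [List.mem_cons, exists_eq_or_imp]
  rw [rowFormula, key, ← sat_transFormula hm]
  simp [mem_letters]

/-- The formula of the state `q`, given formulae for the smaller states.  The meaning of `q` is a
fixpoint of `X ↦ α ∨ (β ∧ ◇X)` or of `X ↦ α ∨ (β ∧ □X)`, where `α` and `β` are the transition
condition of `q` with falsity and truth for its own atoms: the least fixpoint of the first map, or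
the greatest one of the second map. -/
def stateFormula (Φ : Fin A.numStates → Formula m) (q : Fin A.numStates) : Formula m :=
  if q ∈ A.acc then
    .neg (.EU (.neg (rowFormula hm A q false Φ)) (.neg (rowFormula hm A q true Φ)))
  else .EU (rowFormula hm A q true Φ) (rowFormula hm A q false Φ)

/-- The formulae of all states after `j` rounds.  They are correct for the states with fewer than
`j` states below them. -/
def stateFormulas (j : ℕ) : Fin A.numStates → Formula m :=
  (stateFormula hm A)^[j] fun _ => .atom ⟨0, hm⟩

theorem pastFree_transFormula {n : ℕ} (q : Fin n) (b : Bool) {Φ : Fin n → Formula m}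
    (h : ∀ q, (Φ q).PastFree) (θ : PBF (Move false × Fin n)) :
    (transFormula hm q b Φ θ).PastFree := by
  induction θ with
  | tt => trivial
  | ff => trivial
  | and θ η h₁ h₂ => exact ⟨h₁, h₂⟩
  | or θ η h₁ h₂ => exact ⟨h₁, h₂⟩
  | atom a =>
    unfold transFormula
    split_ifs
    · trivial
    · trivial
    · obtain ⟨_ | k, q'⟩ := a <;> exact h q'

theorem pastFree_stateFormulas (j : ℕ) (q : Fin A.numStates) :
    (stateFormulas hm A j q).PastFree := by
  induction j generalizing q with
  | zero => trivial
  | succ j ih =>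
    have hrow : ∀ b, (rowFormula hm A q b (stateFormulas hm A j)).PastFree := by
      intro b
      unfold rowFormula
      induction letters m with
      | nil => trivial
      | cons a l ihl => exact ⟨⟨pastFree_letter a, pastFree_transFormula hm q b ih _⟩, ihl⟩
    rw [stateFormulas, Function.iterate_succ_apply']
    unfold stateFormula
    split_ifs
    · exact ⟨hrow _, hrow _⟩
    · exact ⟨hrow _, hrow _⟩

variable {A} {c : Fin A.numStates → ℕ} (t : SigmaTree (Letter m))

/-- The meaning of the formula of a state does not change any more once there have been more rounds
than there are states below it. -/
theorem stateFormulas_stable (hord : A.Ordered c) (hc : Function.Injective c)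
    (q : Fin A.numStates) (i j : ℕ)
    (hi : (Finset.univ.filter fun q' => c q' < c q).card < i)
    (hj : (Finset.univ.filter fun q' => c q' < c q).card < j) (v : t.Node) :
    (stateFormulas hm A i q).Sat t v ↔ (stateFormulas hm A j q).Sat t v := by
  obtain ⟨n, hn⟩ : ∃ n, n = c q := ⟨_, rfl⟩
  induction n using Nat.strong_induction_on generalizing q i j v with
  | _ n ih =>
  obtain ⟨i, rfl⟩ := Nat.exists_eq_add_of_lt hi
  obtain ⟨j, rfl⟩ := Nat.exists_eq_add_of_lt hj
  set r := (Finset.univ.filter fun q' => c q' < c q).card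
  have hrow : ∀ b v, (rowFormula hm A q b (stateFormulas hm A (r + i))).Sat t v ↔
      (rowFormula hm A q b (stateFormulas hm A (r + j))).Sat t v := by
    intro b v
    have hlow : ∀ a ∈ (A.δ q (t.label v)).atoms, a.2 ≠ q → ∀ v',
        (stateFormulas hm A (r + i) a.2).Sat t v' ↔ (stateFormulas hm A (r + j) a.2).Sat t v' := by
      intro a ha haq v'
      have hlt : c a.2 < c q := lt_of_le_of_ne (hord _ _ a ha) fun h => haq (hc h)
      have hcard : (Finset.univ.filter fun q' => c q' < c a.2).card < r := by
        refine Finset.card_lt_card (Finset.ssubset_iff_of_subset ?_ |>.2 ⟨a.2, ?_, ?_⟩)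
        · exact fun q' hq' => Finset.mem_filter.2
            ⟨Finset.mem_univ _, (Finset.mem_filter.1 hq').2.trans hlt⟩
        · simpa using hlt
        · simp
      exact ih _ (hn ▸ hlt) a.2 _ _ (by omega) (by omega) v' rfl
    rw [sat_rowFormula, sat_rowFormula]
    constructor
    · refine PBF.Sat.mono fun a ha => ?_
      split_ifs with h
      · exact id
      · exact Automaton.ChildSat.mono fun v' _ => (hlow a ha h v').1
    · refine PBF.Sat.mono fun a ha => ?_
      split_ifs with h
      · exact id
      · exact Automaton.ChildSat.mono fun v' _ => (hlow a ha h v').2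
  have hfun : ∀ b, (rowFormula hm A q b (stateFormulas hm A (r + i))).Sat t =
      (rowFormula hm A q b (stateFormulas hm A (r + j))).Sat t :=
    fun b => funext fun v => propext (hrow b v)
  have hsucc : ∀ k, stateFormulas hm A (k + 1) = stateFormula hm A (stateFormulas hm A k) :=
    fun k => Function.iterate_succ_apply' _ _ _
  rw [hsucc, hsucc]
  unfold stateFormula
  have hfun' : ∀ b, (rowFormula hm A q b (stateFormulas hm A (r + i))).neg.Sat t =
      (rowFormula hm A q b (stateFormulas hm A (r + j))).neg.Sat t :=
    fun b => funext fun v => congrArg Not (congrFun (hfun b) v)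
  split_ifs
  · simp only [Sat.eq_2, sat_EU, hfun']
  · simp only [sat_EU, hfun]

/-- Acceptance by a linear automaton is expressed by the formula of its initial state. -/
theorem accepts_iff_sat (hA : A.IsLinear) :
    A.Accepts t t.label ↔ (stateFormulas hm A A.numStates A.init).Sat t t.root := by
  obtain ⟨c, ⟨hord, hcomp⟩, hc⟩ := hA
  set Φ := stateFormulas hm A A.numStates with hΦ
  have hstep : ∀ q v, (Φ q).Sat t v ↔ (stateFormula hm A Φ q).Sat t v := by
    intro q v
    have hlt : (Finset.univ.filter fun q' => c q' < c q).card < A.numStates := by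
      refine (Finset.card_lt_card (Finset.filter_ssubset.2 ⟨q, Finset.mem_univ _, ?_⟩)).trans_eq ?_
      · simp
      · simp
    have := stateFormulas_stable hm t hord hc q _ (A.numStates + 1) hlt (by omega) v
    rwa [stateFormulas, stateFormulas, Function.iterate_succ_apply'] at this
  let S : Bool → Fin A.numStates → t.Node → Prop := fun b q v => (A.δ q (t.label v)).Sat fun a =>
      if a.2 = q then b = true else Automaton.ChildSat t v {x | (Φ x.1).Sat t x.2} a
  have hS : ∀ b q, (rowFormula hm A q b Φ).Sat t = S b q := fun b q =>
    funext fun v => propext (sat_rowFormula hm A q b Φ t v)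
  have hlow : ∀ q v, q ∉ A.acc → ((Φ q).Sat t v ↔ Until t.succ (S true q) (S false q) v) := by
    intro q v hq
    rw [hstep, stateFormula, if_neg hq, sat_EU, hS, hS]
  have hhigh : ∀ q v, q ∈ A.acc → ((Φ q).Sat t v ↔
      ¬ Until t.succ (fun v => ¬ S false q v) (fun v => ¬ S true q v) v) := by
    intro q v hq
    rw [hstep, stateFormula, if_pos hq, Sat, sat_EU]
    simp only [← hS]
    rfl
  have hdia : ∀ q, q ∉ A.acc → ∀ x, ∀ a ∈ (A.δ q x).atoms, a.2 = q → a = (.dia 1, q) := by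
    intro q hq x a ha haq
    rcases hcomp _ ⟨q, rfl⟩ with h | h | h
    · exact absurd (congrArg c haq) (h q rfl x a ha)
    · exact Prod.ext ((h.1 q rfl x).1 a ha (congrArg c haq)) haq
    · exact absurd (h.2 q rfl) hq
  have hbox : ∀ q, q ∈ A.acc → ∀ x, ∀ a ∈ (A.δ q x).atoms, a.2 = q → a = (.box 1, q) := by
    intro q hq x a ha haq
    rcases hcomp _ ⟨q, rfl⟩ with h | h | h
    · exact absurd (congrArg c haq) (h q rfl x a ha)
    · exact absurd hq (h.2 q rfl)
    · exact Prod.ext ((h.1 q rfl x).1 a ha (congrArg c haq)) haq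
  let rank : Fin A.numStates → t.Node → ℕ := fun q =>
    if q ∈ A.acc then untilRank t.succ (fun v => ¬ S false q v) (fun v => ¬ S true q v)
    else untilRank t.succ (S true q) (S false q)
  refine Automaton.IsValuation.accepts_iff (T := fun q v => (Φ q).Sat t v) (rank := rank)
    ⟨?_, ?_, ?_, ?_⟩ hord hc
  · intro q v hq h
    rw [hlow q v hq, until_iff]
    by_cases hex : ∃ v', t.succ v v' ∧ (Φ q).Sat t v'
    · obtain ⟨v', hv', h'⟩ := hex
      refine .inr ⟨h.mono fun a _ hs => ?_, v', hv', (hlow q v' hq).1 h'⟩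
      split_ifs
      · rfl
      · exact hs
    · refine .inl (h.mono fun a ha hs => ?_)
      split_ifs with haq
      · rw [hdia q hq _ a ha haq, Automaton.childSat_dia_one] at hs
        exact absurd hs hex
      · exact hs
  · intro q v hq h
    rw [hhigh q v hq, until_iff] at h
    push Not at h
    obtain ⟨h₁, h₂⟩ := h
    by_cases hf : S false q v
    · refine PBF.Sat.mono (fun a _ hs => ?_) hf
      split_ifs at hs
      exact hs
    · refine PBF.Sat.mono (fun a ha hs => ?_) h₁
      split_ifs at hs with haq
      · rw [hbox q hq _ a ha haq, Automaton.childSat_box_one]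
        exact fun v' hv' => (hhigh q v' hq).2 (h₂ hf v' hv')
      · exact hs
  · intro q v hq h
    rcases until_rank ((hlow q v hq).1 h) with hf | ⟨ht, v', hv', hu, hr⟩
    · refine PBF.Sat.mono (fun a _ hs => ?_) hf
      split_ifs at hs with haq
      exact hs.mono fun v' _ h => ⟨h, fun e => absurd e haq⟩
    · refine PBF.Sat.mono (fun a ha hs => ?_) ht
      split_ifs at hs with haq
      · rw [hdia q hq _ a ha haq, Automaton.childSat_dia_one]
        refine ⟨v', hv', (hlow q v' hq).2 hu, fun _ => ?_⟩
        simpa only [rank, if_neg hq] using hr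
      · exact hs.mono fun v' _ h => ⟨h, fun e => absurd e haq⟩
  · intro q v hq h
    refine (hhigh q v hq).2 fun hu => ?_
    rcases until_rank hu with ht | ⟨hf, v', hv', hu', hr⟩
    · refine ht (h.mono fun a _ hs => ?_)
      split_ifs with haq
      · rfl
      · exact hs.mono fun v' _ h => h.resolve_right fun e => haq e.1
    · refine hf (h.mono fun a ha hs => ?_)
      split_ifs with haq
      · rw [hbox q hq _ a ha haq, Automaton.childSat_box_one] at hs
        rcases hs v' hv' with h' | ⟨-, h'⟩
        · exact absurd hu' ((hhigh q v' hq).1 h')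
        · simp only [rank, if_pos hq] at h'
          exact absurd hr (not_lt.2 h')
      · exact hs.mono fun v' _ h => h.resolve_right fun e => haq e.1

end

/-! ### Computability of the formula of an automaton -/

/-- The list of the values `f 0, …, f (n - 1)` of the function that is given by course-of-values
recursion `f n = g [f 0, …, f (n - 1)]`. -/
def tabulate (g : List ℕ → ℕ) (n : ℕ) : List ℕ := Nat.rec [] (fun _ L => L ++ [g L]) n

theorem tabulate_succ (g : List ℕ → ℕ) (n : ℕ) :
    tabulate g (n + 1) = tabulate g n ++ [g (tabulate g n)] := rfl

theorem length_tabulate (g : List ℕ → ℕ) (n : ℕ) : (tabulate g n).length = n := by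
  induction n with
  | zero => rfl
  | succ n ih => simp [tabulate_succ, ih]

theorem getD_tabulate (g : List ℕ → ℕ) {i n : ℕ} (h : i < n) :
    (tabulate g n).getD i 0 = g (tabulate g i) := by
  induction n with
  | zero => omega
  | succ n ih =>
    rw [tabulate_succ]
    rcases Nat.lt_succ_iff_lt_or_eq.1 h with h | rfl
    · rw [List.getD_append _ _ _ _ (by rwa [length_tabulate]), ih h]
    · rw [List.getD_append_right _ _ _ _ (length_tabulate g i).le]
      simp [length_tabulate]

open Primrec in
theorem primrec_tabulate {β : Type} [Primcodable β] {g : β → List ℕ → ℕ} (hg : Primrec₂ g) :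
    Primrec₂ fun p n => tabulate (g p) n :=
  nat_rec (const []) (list_append.comp (snd.comp snd)
    (list_cons.comp (hg.comp fst (snd.comp snd)) (const []))).to₂

/-- The number of the true formula `Formula.tt`. -/
def codeTT : ℕ := Nat.pair 3 (Nat.pair 0 (Nat.pair 0 0))

/-- The number of a negation, from that of its part; likewise below. -/
def codeNeg (k : ℕ) : ℕ := Nat.pair 1 k

def codeOr (k l : ℕ) : ℕ := Nat.pair 2 (Nat.pair k l)

def codeAnd (k l : ℕ) : ℕ := codeNeg (codeOr (codeNeg k) (codeNeg l))

def codeCount (n k : ℕ) : ℕ := Nat.pair 3 (Nat.pair n k)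

def codeEU (k l : ℕ) : ℕ := Nat.pair 5 (Nat.pair k l)

/-- The number of the translation `transFormula` of the transition formula with number `L.length`,
computed from the list `L` of the numbers for the smaller transition formulae.  The parameters `p`
are the state `q`, the truth value of its own atoms, and the numbers of the formulae of the
states. -/
def transCodeStep (p : ℕ × Bool × List ℕ) (L : List ℕ) : ℕ :=
  let x := L.length.unpair.2
  if L.length.unpair.1 = 0 then if x = 0 then codeTT else codeNeg codeTT
  else if L.length.unpair.1 = 1 then
    if x.unpair.2 = p.1 then cond p.2.1 codeTT (codeNeg codeTT)
    else if x.unpair.1.unpair.1 = 0 then codeCount x.unpair.1.unpair.2 (p.2.2.getD x.unpair.2 0)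
    else codeNeg (codeCount x.unpair.1.unpair.2 (codeNeg (p.2.2.getD x.unpair.2 0)))
  else if L.length.unpair.1 = 2 then codeAnd (L.getD x.unpair.1 0) (L.getD x.unpair.2 0)
  else codeOr (L.getD x.unpair.1 0) (L.getD x.unpair.2 0)

/-- The translation of transition formulae in terms of their numbers. -/
def transCode (p : ℕ × Bool × List ℕ) (k : ℕ) : ℕ :=
  transCodeStep p (tabulate (transCodeStep p) k)

/-- The number of `rowFormula`, computed from the numbers `row` of the transition formulae of a
state and the numbers `χ` of the formulae for the letters. -/
def rowCode (χ : List ℕ) (m : ℕ) (p : ℕ × Bool × List ℕ) (row : List ℕ) : ℕ :=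
  (List.range (2 ^ m)).foldr
    (fun s k => codeOr (codeAnd (χ.getD s 0) (transCode p (row.getD s 0))) k) (codeNeg codeTT)

/-- The number of `stateFormula`, where `e` consists of the initial state, the transition table and
the table of accepting states of the automaton, as in `Automaton.code`. -/
def stateCode (χ : List ℕ) (m : ℕ) (e : ℕ × List (List ℕ) × List Bool) (Φ : List ℕ) (q : ℕ) : ℕ :=
  cond (e.2.2.getD q false)
    (codeNeg (codeEU (codeNeg (rowCode χ m (q, false, Φ) (e.2.1.getD q [])))
      (codeNeg (rowCode χ m (q, true, Φ) (e.2.1.getD q [])))))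
    (codeEU (rowCode χ m (q, true, Φ) (e.2.1.getD q []))
      (rowCode χ m (q, false, Φ) (e.2.1.getD q [])))

/-- The number of the formula of the initial state.  The iteration starts with an empty list, since
`0`, the default value of its entries, is the number of the atom that `stateFormulas` starts
with. -/
def automatonCode (χ : List ℕ) (m : ℕ) (e : ℕ × List (List ℕ) × List Bool) : ℕ :=
  ((fun Φ => (List.range e.2.1.length).map (stateCode χ m e Φ))^[e.2.1.length] []).getD e.1 0

section correctness

variable {m : ℕ} (hm : 0 < m)

theorem transCode_eq {n : ℕ} (q : Fin n) (b : Bool) (Φ : Fin n → Formula m) (L : List ℕ)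
    (hL : ∀ q : Fin n, L.getD q 0 = (Φ q).code) (θ : PBF (Move false × Fin n)) :
    transCode (q, b, L) (θ.code fun a => Nat.pair a.1.code (a.2 : ℕ)) =
      (transFormula hm q b Φ θ).code := by
  have hsub : ∀ i j k : ℕ, (tabulate (transCodeStep (q, b, L))
        (Nat.pair (k + 1) (Nat.pair i j))).getD i 0 = transCode (q, b, L) i ∧
      (tabulate (transCodeStep (q, b, L))
        (Nat.pair (k + 1) (Nat.pair i j))).getD j 0 = transCode (q, b, L) j := by
    intro i j k
    have h1 := Nat.add_le_pair (k + 1) (Nat.pair i j)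
    have h2 := Nat.add_le_pair i j
    exact ⟨getD_tabulate _ (by omega), getD_tabulate _ (by omega)⟩
  induction θ with
  | tt =>
    rw [transCode, transCodeStep]
    simp [length_tabulate, PBF.code, transFormula, Formula.tt, Formula.code, codeTT]
  | ff =>
    rw [transCode, transCodeStep]
    simp [length_tabulate, PBF.code, transFormula, Formula.tt, Formula.ff, Formula.code, codeTT,
      codeNeg]
  | atom a =>
    rw [transCode, transCodeStep]
    obtain ⟨_ | k, q'⟩ := a
    all_goals
      by_cases hq : q' = q
      · cases b <;> simp [length_tabulate, PBF.code, transFormula, hq, Formula.tt, Formula.ff,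
          Formula.code, codeTT, codeNeg]
      · have := Fin.val_ne_of_ne hq
        simp [length_tabulate, PBF.code, transFormula, hq, this, Move.code, moveFormula,
          Formula.code, codeCount, codeNeg, ← hL]
  | and θ η h₁ h₂ =>
    rw [transCode, transCodeStep]
    simp only [length_tabulate, PBF.code, Nat.unpair_pair, hsub _ _ 1, h₁, h₂]
    simp [transFormula, Formula.and, Formula.code, codeAnd, codeOr, codeNeg]
  | or θ η h₁ h₂ =>
    rw [transCode, transCodeStep]
    simp only [length_tabulate, PBF.code, Nat.unpair_pair, hsub _ _ 2, h₁, h₂]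
    simp [transFormula, Formula.code, codeOr]

variable (A : GTA m)

/-- The numbers of the formulae that characterize the letters. -/
def letterCodes : List ℕ := (letters m).map fun a => (Formula.letter hm a).code

theorem rowCode_eq (q : Fin A.numStates) (b : Bool) (Φ : Fin A.numStates → Formula m) (L : List ℕ)
    (hL : ∀ q : Fin A.numStates, L.getD q 0 = (Φ q).code) :
    rowCode (letterCodes hm) m (q, b, L)
      ((letters m).map fun a => (A.δ q a).code fun a => Nat.pair a.1.code (a.2 : ℕ)) =
        (rowFormula hm A q b Φ).code := by
  rw [rowCode, rowFormula, letterCodes]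
  have hff : codeNeg codeTT = (Formula.ff hm).code := rfl
  have hcode : ∀ l : List (Letter m), (l.foldr (fun a φ =>
      Formula.or (.and (Formula.letter hm a) (transFormula hm q b Φ (A.δ q a))) φ)
        (Formula.ff hm)).code = l.foldr (fun a k => codeOr (codeAnd (Formula.letter hm a).code
          (transFormula hm q b Φ (A.δ q a)).code) k) (Formula.ff hm).code := by
    intro l
    induction l with
    | nil => rfl
    | cons a l ih => rw [List.foldr_cons, List.foldr_cons, ← ih]; rfl
  rw [hff, hcode]
  conv_rhs => rw [letters, List.foldr_map]
  refine List.foldr_ext _ _ _ fun s hs k => ?_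
  have hs' := List.mem_range.1 hs
  simp only [List.getD, letters, List.getElem?_map, List.getElem?_range hs', Option.map_some,
    Option.getD_some]
  rw [transCode_eq hm q b Φ L hL]

theorem automatonCode_eq : automatonCode (letterCodes hm) m ((A.init : ℕ),
    List.ofFn (fun q => (letters m).map fun x =>
      (A.δ q x).code fun a => Nat.pair a.1.code (a.2 : ℕ)),
    List.ofFn (fun q => decide (q ∈ A.acc))) = (stateFormulas hm A A.numStates A.init).code := by
  rw [automatonCode]
  simp only [List.length_ofFn]
  set e : ℕ × List (List ℕ) × List Bool := ((A.init : ℕ),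
    List.ofFn (fun q => (letters m).map fun x =>
      (A.δ q x).code fun a => Nat.pair a.1.code (a.2 : ℕ)),
    List.ofFn (fun q => decide (q ∈ A.acc)))
  have key : ∀ (j : ℕ) (q : Fin A.numStates),
      ((fun Φ => (List.range A.numStates).map (stateCode (letterCodes hm) m e Φ))^[j] []).getD q 0 =
        (stateFormulas hm A j q).code := by
    intro j
    induction j with
    | zero => exact fun q => rfl
    | succ j ih =>
      intro q
      rw [Function.iterate_succ_apply', stateFormulas, Function.iterate_succ_apply',
        ← stateFormulas]
      have hrow : e.2.1.getD q [] = (letters m).map fun x =>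
          (A.δ q x).code fun a => Nat.pair a.1.code (a.2 : ℕ) := by
        simp [e, List.getD]
      have hacc : e.2.2.getD q false = decide (q ∈ A.acc) := by
        simp [e, List.getD]
      simp only [List.getD, List.getElem?_map, List.getElem?_range q.2, Option.map_some,
        Option.getD_some]
      rw [stateCode, hrow, hacc, rowCode_eq hm A q false _ _ ih, rowCode_eq hm A q true _ _ ih,
        stateFormula]
      by_cases hq : q ∈ A.acc
      · simp only [hq, decide_true, cond_true, if_true]
        rfl
      · simp only [hq, decide_false, cond_false, if_false]
        rfl
  exact key _ _

end correctness

section computability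

open Primrec

theorem primrec_codeNeg : Primrec codeNeg := Primrec₂.natPair.comp (const 1) Primrec.id

theorem primrec_codeOr : Primrec₂ codeOr :=
  Primrec₂.natPair.comp₂ (Primrec₂.const 2) Primrec₂.natPair

theorem primrec_codeAnd : Primrec₂ codeAnd :=
  primrec_codeNeg.comp₂ (primrec_codeOr.comp₂ (primrec_codeNeg.comp₂ Primrec₂.left)
    (primrec_codeNeg.comp₂ Primrec₂.right))

theorem primrec_codeCount : Primrec₂ codeCount :=
  Primrec₂.natPair.comp₂ (Primrec₂.const 3) Primrec₂.natPair

theorem primrec_codeEU : Primrec₂ codeEU :=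
  Primrec₂.natPair.comp₂ (Primrec₂.const 5) Primrec₂.natPair

theorem primrec_transCodeStep : Primrec₂ transCodeStep := by
  have hlen : Primrec fun p : (ℕ × Bool × List ℕ) × List ℕ => p.2.length.unpair :=
    unpair.comp (list_length.comp snd)
  have htag : Primrec fun p : (ℕ × Bool × List ℕ) × List ℕ => p.2.length.unpair.1 := fst.comp hlen
  have hx : Primrec fun p : (ℕ × Bool × List ℕ) × List ℕ => p.2.length.unpair.2 := snd.comp hlen
  have hx1 : Primrec fun p : (ℕ × Bool × List ℕ) × List ℕ => p.2.length.unpair.2.unpair.1 :=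
    fst.comp (unpair.comp hx)
  have hx2 : Primrec fun p : (ℕ × Bool × List ℕ) × List ℕ => p.2.length.unpair.2.unpair.2 :=
    snd.comp (unpair.comp hx)
  have hmv := fst.comp (unpair.comp hx1)
  have hk := snd.comp (unpair.comp hx1)
  have hΦ : Primrec fun p : (ℕ × Bool × List ℕ) × List ℕ =>
      p.1.2.2.getD p.2.length.unpair.2.unpair.2 0 :=
    (list_getD 0).comp (snd.comp (snd.comp fst)) hx2
  have h1 : Primrec fun p : (ℕ × Bool × List ℕ) × List ℕ =>
      p.2.getD p.2.length.unpair.2.unpair.1 0 := (list_getD 0).comp snd hx1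
  have h2 : Primrec fun p : (ℕ × Bool × List ℕ) × List ℕ =>
      p.2.getD p.2.length.unpair.2.unpair.2 0 := (list_getD 0).comp snd hx2
  unfold transCodeStep
  exact ite (Primrec.eq.comp htag (const 0))
      (ite (Primrec.eq.comp hx (const 0)) (const _) (const _)) <|
    ite (Primrec.eq.comp htag (const 1))
      (ite (Primrec.eq.comp hx2 (fst.comp fst))
        (Primrec.cond (fst.comp (snd.comp fst)) (const _) (const _)) <|
        ite (Primrec.eq.comp hmv (const 0)) (primrec_codeCount.comp hk hΦ)
          (primrec_codeNeg.comp (primrec_codeCount.comp hk (primrec_codeNeg.comp hΦ)))) <|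
    ite (Primrec.eq.comp htag (const 2)) (primrec_codeAnd.comp h1 h2) (primrec_codeOr.comp h1 h2)

theorem primrec_transCode : Primrec₂ transCode :=
  primrec_transCodeStep.comp₂ Primrec₂.left (primrec_tabulate primrec_transCodeStep)

theorem primrec_rowCode (χ : List ℕ) (m : ℕ) : Primrec₂ (rowCode χ m) := by
  have hχ : Primrec fun p : ((ℕ × Bool × List ℕ) × List ℕ) × ℕ × ℕ => χ.getD p.2.1 0 :=
    (list_getD 0).comp (const χ) (fst.comp snd)
  have hθ : Primrec fun p : ((ℕ × Bool × List ℕ) × List ℕ) × ℕ × ℕ => p.1.2.getD p.2.1 0 :=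
    (list_getD 0).comp (snd.comp fst) (fst.comp snd)
  exact list_foldr (const _) (const _) (primrec_codeOr.comp (primrec_codeAnd.comp hχ
    (primrec_transCode.comp (fst.comp fst) hθ)) (snd.comp snd)).to₂

theorem primrec_automatonCode (χ : List ℕ) (m : ℕ) : Primrec (automatonCode χ m) := by
  have hlen : Primrec fun e : ℕ × List (List ℕ) × List Bool => e.2.1.length :=
    list_length.comp (fst.comp snd)
  refine (list_getD 0).comp (nat_iterate hlen (const []) ?_) fst
  refine list_map (list_range.comp (hlen.comp fst)) ?_
  have hq : Primrec fun p : ((ℕ × List (List ℕ) × List Bool) × List ℕ) × ℕ => p.2 := snd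
  have hrow := (list_getD (α := List ℕ) []).comp
    ((fst.comp (snd.comp (fst.comp fst))) :
      Primrec fun p : ((ℕ × List (List ℕ) × List Bool) × List ℕ) × ℕ => p.1.1.2.1) hq
  have hacc := (list_getD false).comp
    ((snd.comp (snd.comp (fst.comp fst))) :
      Primrec fun p : ((ℕ × List (List ℕ) × List Bool) × List ℕ) × ℕ => p.1.1.2.2) hq
  have h : ∀ b : Bool, Primrec fun p : ((ℕ × List (List ℕ) × List Bool) × List ℕ) × ℕ =>
      rowCode χ m (p.2, b, p.1.2) (p.1.1.2.1.getD p.2 []) := fun b =>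
    (primrec_rowCode χ m).comp (hq.pair ((const b).pair (snd.comp fst))) hrow
  exact Primrec.cond hacc
    (primrec_codeNeg.comp (primrec_codeEU.comp (primrec_codeNeg.comp (h false))
      (primrec_codeNeg.comp (h true))))
    (primrec_codeEU.comp (h true) (h false))

end computability

theorem linearHTA_translatesTo_polCTL {m : ℕ} (hm : 0 < m) :
    (linearHTA m).TranslatesTo (polCTL m) := by
  refine ⟨fun k => ((Encodable.decode k).map (automatonCode (letterCodes hm) m)).getD 0,
    (Primrec.option_getD.comp (Primrec.option_map Primrec.decode
      ((primrec_automatonCode _ m).comp Primrec.snd).to₂) (Primrec.const 0)).to_comp,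
    fun A => ⟨⟨stateFormulas hm A.1 A.1.numStates A.1.init,
      pastFree_stateFormulas hm A.1 _ _⟩, ?_, ?_⟩⟩
  · refine (automatonCode_eq hm A.1).symm.trans ?_
    simp only [linearHTA, Automaton.code, Encodable.encodek, Option.map_some, Option.getD_some]
  · ext t
    exact (accepts_iff_sat hm t A.2).symm

/-! ### One-way automata as two-way automata -/

/-- A move of a one-way automaton as a move of a two-way automaton. -/
def Move.lift : Move false → Move true
  | .dia k => .dia k
  | .box k => .box k

/-- A one-way automaton as a two-way automaton that never moves upwards. -/
def GTA.lift {m : ℕ} (A : GTA m) : TwoWayGTA m where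
  numStates := A.numStates
  δ q x := (A.δ q x.1).map (Prod.map Move.lift id)
  init := A.init
  acc := A.acc

section lift

variable {m : ℕ} (A : GTA m)

theorem GTA.mem_atoms_lift {q : Fin A.numStates} {x : Letter m × Position}
    {a : Move true × Fin A.numStates} (ha : a ∈ (A.lift.δ q x).atoms) :
    ∃ mv, a.1 = Move.lift mv ∧ (mv, a.2) ∈ (A.δ q x.1).atoms := by
  obtain ⟨b, hb, rfl⟩ := (PBF.atoms_map _ _).subset ha
  exact ⟨b.1, rfl, hb⟩

theorem GTA.lift_isLinear (hA : A.IsLinear) : TwoWayGTA.IsLinear A.lift := by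
  obtain ⟨c, ⟨hord, hcomp⟩, hc⟩ := hA
  refine ⟨c, hc, fun q x a ha => ?_, fun i hi => ?_⟩
  · obtain ⟨mv, -, h⟩ := A.mem_atoms_lift ha
    exact hord q x.1 _ h
  · rcases hcomp i hi with h | h | h
    · refine .inl fun q hq x a ha => ?_
      obtain ⟨mv, -, h'⟩ := A.mem_atoms_lift ha
      exact h q hq x.1 _ h'
    · refine .inr (.inl ⟨Automaton.existential_of_injective (A := A.lift) hc
        fun q hq x a ha hai => ?_, h.2⟩)
      obtain ⟨mv, e, h'⟩ := A.mem_atoms_lift ha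
      obtain rfl := (h.1 q hq x.1).1 _ h' hai
      exact e
    · refine .inr (.inr (.inl ⟨Automaton.universal_of_injective (A := A.lift) hc
        fun q hq x a ha hai => ?_, h.2⟩))
      obtain ⟨mv, e, h'⟩ := A.mem_atoms_lift ha
      obtain rfl := (h.1 q hq x.1).1 _ h' hai
      exact e

theorem GTA.lang_lift : TwoWayGTA.lang A.lift = A.lang := by
  ext t
  refine exists_congr fun r => and_congr_left fun _ => and_congr_right fun _ =>
    forall_congr' fun u => (PBF.sat_map _ _ _).trans ?_
  have : Automaton.AtomSat t r u ∘ Prod.map Move.lift id = Automaton.AtomSat t r u := by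
    funext ⟨mv, q⟩
    rcases mv with _ | _ <;> rfl
  exact iff_of_eq (congrArg
    (fun s => PBF.Sat s (A.δ (r.label u).1 (t.label (r.label u).2))) this)

/-- Each row of the transition table is repeated, for the root and for the other nodes. -/
theorem GTA.code_lift : A.lift.code ((letters m).map (·, .root) ++ (letters m).map (·, .nonRoot)) =
    Encodable.encode ((A.init : ℕ),
      (List.ofFn (fun q => (letters m).map fun x =>
        (A.δ q x).code fun a => Nat.pair a.1.code (a.2 : ℕ))).map (fun r => r ++ r),
      List.ofFn (fun q => decide (q ∈ A.acc))) := by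
  have h : ∀ q x, (A.lift.δ q x).code (fun a => Nat.pair a.1.code (a.2 : ℕ)) =
      (A.δ q x.1).code fun a => Nat.pair a.1.code (a.2 : ℕ) := fun q x =>
    PBF.code_map _ _ _ _ fun a _ => by rcases a with ⟨_ | _, q'⟩ <;> rfl
  unfold Automaton.code
  simp only [h, List.map_append, List.map_map, List.map_ofFn]
  rfl

open Primrec in
theorem linearHTA_translatesTo_twoWayLinearHTA (m : ℕ) :
    (linearHTA m).TranslatesTo (twoWayLinearHTA m) := by
  have hF : Primrec fun e : ℕ × List (List ℕ) × List Bool =>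
      Encodable.encode (e.1, e.2.1.map (fun r => r ++ r), e.2.2) :=
    Primrec.encode.comp (Primrec.pair fst (Primrec.pair
      (list_map (fst.comp snd) (list_append.comp snd snd).to₂) (snd.comp snd)))
  refine ⟨fun k => ((Encodable.decode k).map fun e : ℕ × List (List ℕ) × List Bool =>
      Encodable.encode (e.1, e.2.1.map (fun r => r ++ r), e.2.2)).getD 0,
    (option_getD.comp (option_map Primrec.decode (hF.comp snd).to₂) (const 0)).to_comp,
    fun A => ⟨⟨A.1.lift, A.1.lift_isLinear A.2⟩, ?_, A.1.lang_lift⟩⟩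
  refine A.1.code_lift.trans ?_
  simp only [linearHTA, Automaton.code, Encodable.encodek, Option.map_some, Option.getD_some]

end lift

/-! ### A language that needs the past -/

section language

variable {m : ℕ} (hm : 0 < m) (t : SigmaTree (Letter m))

/-- The truth value of the first proposition differs from that at the parent, if there is one. -/
def Alternates (v : t.Node) : Prop :=
  ∀ u, t.succ u v → (⟨0, hm⟩ ∈ t.label u ↔ ⟨0, hm⟩ ∉ t.label v)

/-- The node has a single successor: in a tree without leaves, fewer than two. -/
def Thin (v : t.Node) : Prop := {v' | t.succ v v'}.ncard < 2

/-- From `v` there is a finite path to a node with a single successor such that the truth value of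
the first proposition changes in each step, including the one that leads to `v`. -/
def AlternatingToThin (v : t.Node) : Prop :=
  Until t.succ (Alternates hm t) (fun v => Alternates hm t v ∧ Thin t v) v

/-- `Alternates` as a formula: neither does the proposition hold here and at the parent, nor does it
fail at both. -/
def alternatesFormula : Formula m :=
  .neg (.or (.and (.atom ⟨0, hm⟩) (.EY (.atom ⟨0, hm⟩)))
    (.and (.neg (.atom ⟨0, hm⟩)) (.EY (.neg (.atom ⟨0, hm⟩)))))

/-- `AlternatingToThin` as a formula. -/
def alternatingFormula : Formula m :=
  .EU (alternatesFormula hm)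
    (.and (alternatesFormula hm) (.neg (.count 2 (Formula.tt hm))))

theorem sat_alternatesFormula (v : t.Node) :
    (alternatesFormula hm).Sat t v ↔ Alternates hm t v := by
  simp only [alternatesFormula, Formula.Sat.eq_2, Formula.Sat.eq_3, Formula.sat_and,
    Formula.sat_EY, Alternates]
  simp only [Formula.Sat]
  constructor
  · intro h u hu
    by_contra hne
    exact h (by
      by_cases hp : (⟨0, hm⟩ : Fin m) ∈ t.label v
      · exact .inl ⟨hp, u, hu, by tauto⟩
      · exact .inr ⟨hp, u, hu, by tauto⟩)
  · rintro h (⟨hp, u, hu, hu'⟩ | ⟨hp, u, hu, hu'⟩)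
    · exact (h u hu).1 hu' hp
    · exact hu' ((h u hu).2 hp)

theorem mem_lang_alternatingFormula :
    t ∈ (alternatingFormula hm).lang ↔ AlternatingToThin hm t t.root := by
  refine Formula.sat_EU.trans ?_
  have h₁ : (alternatesFormula hm).Sat t = Alternates hm t :=
    funext fun v => propext (sat_alternatesFormula hm t v)
  have h₂ : (Formula.and (alternatesFormula hm) (.neg (.count 2 (Formula.tt hm)))).Sat t =
      fun v => Alternates hm t v ∧ Thin t v := by
    funext v
    refine propext (Formula.sat_and.trans (and_congr (sat_alternatesFormula hm t v) ?_))
    refine (not_congr ?_).trans not_le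
    rw [← exists_finset_card_iff (t.finite_succ v)]
    exact exists_congr fun S => and_congr_right fun _ => forall₂_congr fun v' _ =>
      and_iff_left Formula.sat_tt
  rw [h₁, h₂]
  rfl

/-- The transitions of a two-way automaton for the same language: state `0` rejects, `1` and `2`
test the first proposition, and `3` guesses the path and compares each node with its parent. -/
def alternatingDelta (q : ℕ) (x : Letter m × Position) : PBF (Move true × ℕ) :=
  match q with
  | 1 => if ⟨0, hm⟩ ∈ x.1 then .tt else .ff
  | 2 => if ⟨0, hm⟩ ∈ x.1 then .ff else .tt
  | 3 => .and
      (match x.2 with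
        | .root => .tt
        | .nonRoot => .atom (.up, if ⟨0, hm⟩ ∈ x.1 then 2 else 1))
      (.or (.atom (.box 2, 0)) (.atom (.dia 1, 3)))
  | _ => .ff

/-- The two-way automaton with the transitions `alternatingDelta`.  No state is accepting, so the
guessed path has to end. -/
def alternatingAutomaton : TwoWayGTA m :=
  Automaton.ofNat 3 (alternatingDelta hm) 3 fun _ => false

theorem alternatingDelta_atoms (q : ℕ) (x : Letter m × Position) :
    ∀ a ∈ (alternatingDelta hm q x).atoms, a.2 ≤ q ∧ (a.2 = q → a.1 = .dia 1) := by
  intro a ha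
  unfold alternatingDelta at ha
  split at ha
  · split_ifs at ha <;> exact ha.elim
  · split_ifs at ha <;> exact ha.elim
  · rcases ha with ha | ha | ha
    · split at ha
      · exact ha.elim
      · cases Set.mem_singleton_iff.1 ha
        dsimp only
        split_ifs <;> omega
    · cases Set.mem_singleton_iff.1 ha
      dsimp only
      omega
    · cases Set.mem_singleton_iff.1 ha
      exact ⟨le_rfl, fun _ => rfl⟩
  · exact ha.elim

theorem alternatingAutomaton_isLinear : (alternatingAutomaton hm).IsLinear := by
  have hD : ∀ (q : ℕ) (x : Letter m × Position), ∀ a ∈ (alternatingDelta hm q x).atoms, a.2 ≤ q :=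
    fun q x a ha => (alternatingDelta_atoms hm q x a ha).1
  refine ⟨Fin.val, Fin.val_injective, Automaton.ordered_ofNat hD, ?_⟩
  rintro _ ⟨q, rfl⟩
  refine .inr (.inl ⟨Automaton.existential_of_injective Fin.val_injective
    fun q' hq' x a ha h => ?_, fun q' _ hacc => ?_⟩)
  · exact (alternatingDelta_atoms hm _ _ _ (Automaton.mem_atoms_ofNat hD q' x ha)).2
      (h.trans hq'.symm)
  · exact Bool.noConfusion ((Automaton.mem_acc_ofNat q').1 hacc)

theorem mem_lang_alternatingAutomaton :
    t ∈ (alternatingAutomaton hm).lang ↔ AlternatingToThin hm t t.root := by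
  let T : ℕ → t.Node → Prop := fun q v =>
    (q = 1 ∧ ⟨0, hm⟩ ∈ t.label v) ∨ (q = 2 ∧ ⟨0, hm⟩ ∉ t.label v) ∨
      (q = 3 ∧ AlternatingToThin hm t v)
  -- The transition formula of state `3` for a set `C` of labels of children.
  have hδ : ∀ v (C : Set (ℕ × t.Node)),
      (∀ x : ℕ × t.Node, x.1 < 3 → (x ∈ C ↔ T x.1 x.2)) →
      ((alternatingDelta hm 3 (observe t v)).Sat (Automaton.ChildSat t v C) ↔
        Alternates hm t v ∧ (Thin t v ∨ ∃ v', t.succ v v' ∧ (3, v') ∈ C)) := by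
    intro v C hC
    refine and_congr ?_ (or_congr ?_ Automaton.childSat_dia_one)
    · by_cases hv : v = t.root
      · subst hv
        simp only [observe, if_true]
        exact iff_of_true trivial fun u hu => absurd hu (t.root_no_pred u)
      · obtain ⟨u, hu⟩ : ∃ u, t.succ u v := by
          rcases Relation.ReflTransGen.cases_tail (t.reachable v) with h | ⟨u, -, hu⟩
          · exact absurd h hv
          · exact ⟨u, hu⟩
        have hal : Alternates hm t v ↔ (⟨0, hm⟩ ∈ t.label u ↔ ⟨0, hm⟩ ∉ t.label v) :=
          ⟨fun h => h u hu, fun h u' hu' => by rwa [t.pred_unique _ _ _ hu' hu]⟩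
        have hup : ∀ k, Automaton.ChildSat t v C ((Move.up : Move true), k) ↔ (k, u) ∈ C :=
          fun k => ⟨fun ⟨u', hu', h⟩ => by rwa [t.pred_unique _ _ _ hu hu'], fun h => ⟨u, hu, h⟩⟩
        simp only [observe, if_neg hv]
        refine (hup _).trans ?_
        rw [hal]
        split_ifs with hp
        · rw [hC _ (by simp)]
          simp [T, hp]
        · rw [hC _ (by simp)]
          simp [T, hp]
    · have : ∀ v', (0, v') ∉ C := fun v' h => by
        have := (hC (0, v') (by simp)).1 h
        simp [T] at this
      simp [Automaton.ChildSat, PBF.Sat, Thin, this]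
  have hU : ∀ v, AlternatingToThin hm t v ↔
      Alternates hm t v ∧ (Thin t v ∨ ∃ v', t.succ v v' ∧ AlternatingToThin hm t v') := by
    intro v
    rw [AlternatingToThin, until_iff, ← and_or_left]
    rfl
  refine (Automaton.ofNat_accepts_iff (fun q x a ha => (alternatingDelta_atoms hm q x a ha).1)
    (by omega) T
    (fun _ => untilRank t.succ (Alternates hm t) (fun v => Alternates hm t v ∧ Thin t v))
    ?_ (fun _ _ h => Bool.noConfusion h) ?_ (fun _ _ h => Bool.noConfusion h)).trans ?_
  · rintro q v - h
    match q with
    | 0 => exact h.elim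
    | 1 =>
      by_cases hp : (⟨0, hm⟩ : Fin m) ∈ t.label v
      · simp [T, hp]
      · simp [alternatingDelta, observe, hp, PBF.Sat] at h
    | 2 =>
      by_cases hp : (⟨0, hm⟩ : Fin m) ∈ t.label v
      · simp [alternatingDelta, observe, hp, PBF.Sat] at h
      · simp [T, hp]
    | 3 =>
      have h := (hδ v {x | T x.1 x.2} fun _ _ => Iff.rfl).1 h
      refine .inr (.inr ⟨rfl, (hU v).2 ?_⟩)
      simpa [T] using h
    | q + 4 => exact h.elim
  · rintro q v - (⟨rfl, hp⟩ | ⟨rfl, hp⟩ | ⟨rfl, hv⟩)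
    · simp [alternatingDelta, observe, hp, PBF.Sat]
    · simp [alternatingDelta, observe, hp, PBF.Sat]
    · refine (hδ v {x | T x.1 x.2 ∧ (x.1 = 3 → untilRank t.succ (Alternates hm t)
        (fun v => Alternates hm t v ∧ Thin t v) x.2 < untilRank t.succ (Alternates hm t)
        (fun v => Alternates hm t v ∧ Thin t v) v)} fun x hx =>
          ⟨fun h => h.1, fun h => ⟨h, fun e => absurd e hx.ne⟩⟩).2 ?_
      rcases until_rank hv with h | ⟨h, v', hv', hu, hr⟩
      · exact ⟨h.1, .inl h.2⟩
      · exact ⟨h, .inr ⟨v', hv', .inr (.inr ⟨rfl, hu⟩), fun _ => hr⟩⟩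
  · simp [T]

end language

/-! ### Past-free formulae on unfoldings -/

section kripke

variable {X : Type} {m : ℕ}

/-- Past-free formulae evaluated in a graph; distinct successors are distinct vertices. -/
def GraphSat (R : X → X → Prop) (f : X → Letter m) : Formula m → X → Prop
  | .atom p, x => p ∈ f x
  | .neg φ, x => ¬ GraphSat R f φ x
  | .or φ ψ, x => GraphSat R f φ x ∨ GraphSat R f ψ x
  | .count n φ, x => ∃ S : Finset X, S.card = n ∧ ∀ y ∈ S, R x y ∧ GraphSat R f φ y
  | .EX φ, x => ∃ y, R x y ∧ GraphSat R f φ y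
  | .EU φ ψ, x => Until R (GraphSat R f φ) (GraphSat R f ψ) x
  | .EY _, _ => False
  | .ES _ _, _ => False

/-- `e` maps the tree `t` onto a part of the graph `R` that is closed under successors, and is
bijective between the successors of a node and those of its image. -/
structure IsCover (R : X → X → Prop) (f : X → Letter m) (t : SigmaTree (Letter m))
    (e : t.Node → X) : Prop where
  label : ∀ u, t.label u = f (e u)
  succ : ∀ {u v}, t.succ u v → R (e u) (e v)
  exists_succ : ∀ u {y}, R (e u) y → ∃ v, t.succ u v ∧ e v = y
  injOn : ∀ {u v v'}, t.succ u v → t.succ u v' → e v = e v' → v = v'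

/-- A graph without sinks is covered by its unfolding. -/
theorem exists_isCover {R : X → X → Prop} (hR : ∀ x, {y | R x y}.Finite) (hR' : ∀ x, ∃ y, R x y)
    (f : X → Letter m) (x₀ : X) : ∃ t e, IsCover R f t e ∧ e t.root = x₀ :=
  ⟨⟨unfold R hR f x₀, fun u => (hR' (unfoldEnd (hR := hR) u)).elim fun _ hy =>
    (unfold_exists_succ u hy).imp fun _ h => h.1⟩, unfoldEnd (hR := hR) (f := f) (x₀ := x₀),
    ⟨fun _ => rfl, unfold_succ_end (hR := hR), unfold_exists_succ (hR := hR),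
      unfold_succ_injOn (hR := hR)⟩, rfl⟩

variable {R : X → X → Prop} {f : X → Letter m} {t : SigmaTree (Letter m)} {e : t.Node → X}

/-- Past-free formulae hold at a node of a covering tree as they do at its image. -/
theorem IsCover.sat_iff (he : IsCover R f t e) {φ : Formula m} (hφ : φ.PastFree) (u : t.Node) :
    φ.Sat t u ↔ GraphSat R f φ (e u) := by
  induction φ generalizing u with
  | atom p => rw [Formula.Sat, he.label]; rfl
  | neg φ ih => exact not_congr (ih hφ u)
  | or φ ψ ih₁ ih₂ => exact or_congr (ih₁ hφ.1 u) (ih₂ hφ.2 u)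
  | count n φ ih =>
    classical
    constructor
    · rintro ⟨S, rfl, hS⟩
      refine ⟨S.image e, Finset.card_image_of_injOn fun v hv v' hv' h =>
        he.injOn (hS v hv).1 (hS v' hv').1 h, ?_⟩
      intro y hy
      obtain ⟨v, hv, rfl⟩ := Finset.mem_image.1 hy
      exact ⟨he.succ (hS v hv).1, (ih hφ v).1 (hS v hv).2⟩
    · rintro ⟨S, rfl, hS⟩
      choose g hg hg' using fun y : S => he.exists_succ u (hS y.1 y.2).1
      refine ⟨Finset.univ.image g, ?_, ?_⟩
      · rw [Finset.card_image_of_injective _ fun y y' h => Subtype.ext ?_]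
        · simp
        · rw [← hg' y, ← hg' y', h]
      · intro v hv
        obtain ⟨y, -, rfl⟩ := Finset.mem_image.1 hv
        exact ⟨hg y, (ih hφ _).2 (by rw [hg' y]; exact (hS y.1 y.2).2)⟩
  | EX φ ih =>
    rw [Formula.sat_EX]
    constructor
    · rintro ⟨v, hv, h⟩
      exact ⟨_, he.succ hv, (ih hφ v).1 h⟩
    · rintro ⟨y, hy, h⟩
      obtain ⟨v, hv, rfl⟩ := he.exists_succ u hy
      exact ⟨v, hv, (ih hφ v).2 h⟩
  | EU φ ψ ih₁ ih₂ =>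
    rw [Formula.sat_EU]
    constructor
    · intro h
      refine h.induction (C := fun u => GraphSat R f (.EU φ ψ) (e u)) ?_ ?_
      · exact fun v hv => until_iff.2 (.inl ((ih₂ hφ.2 v).1 hv))
      · exact fun v v' hv hs h => until_iff.2 (.inr ⟨(ih₁ hφ.1 v).1 hv, _, he.succ hs, h⟩)
    · rintro ⟨n, hn⟩
      refine ⟨n, ?_⟩
      induction n generalizing u with
      | zero => exact (ih₂ hφ.2 u).2 hn
      | succ n ihn =>
        obtain ⟨h, y, hy, hy'⟩ := hn
        obtain ⟨v, hv, rfl⟩ := he.exists_succ u hy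
        exact ⟨(ih₁ hφ.1 u).2 h, v, hv, ihn v hy'⟩
  | EY φ => exact hφ.elim
  | ES φ ψ => exact hφ.elim

end kripke

/-! ### Two trees that no past-free formula separates -/

/-- The vertices `(n, l, s)` have a level `n`, a label `l` and a switch `s`. This is the successor
with the same label, one level below. -/
def keepSucc : ℕ × Bool × Bool → ℕ × Bool × Bool
  | (0, l, s) => (0, l, s)
  | (n + 1, l, _) => (n, l, false)

/-- The successor with the other label. It is one level below, too, unless the switch is on: then
the level does not change, so that going down requires two equal labels in succession. -/
def flipSucc : ℕ × Bool × Bool → ℕ × Bool × Bool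
  | (0, l, s) => (0, l, s)
  | (n + 1, l, false) => (n, !l, false)
  | (n + 1, l, true) => (n + 1, !l, true)

/-- The successor relation of the graph of levels. -/
def LevelSucc (x y : ℕ × Bool × Bool) : Prop := y = keepSucc x ∨ y = flipSucc x

theorem levelSucc_finite (x : ℕ × Bool × Bool) : {y | LevelSucc x y}.Finite :=
  (Set.toFinite {keepSucc x, flipSucc x}).subset fun _ hy => hy

theorem levelSucc_total (x : ℕ × Bool × Bool) : ∃ y, LevelSucc x y := ⟨_, .inl rfl⟩

theorem keepSucc_ne_flipSucc (n : ℕ) (l s : Bool) :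
    keepSucc (n + 1, l, s) ≠ flipSucc (n + 1, l, s) := by
  cases s <;> cases l <;> simp [keepSucc, flipSucc]

/-- From level `d` on, the predicate depends on the label only. -/
def StableFrom (d : ℕ) (P : ℕ × Bool × Bool → Prop) : Prop :=
  ∀ l n s n' s', d ≤ n → d ≤ n' → (P (n, l, s) ↔ P (n', l, s'))

theorem StableFrom.mono {d d' : ℕ} {P : ℕ × Bool × Bool → Prop} (h : StableFrom d P)
    (hd : d ≤ d') : StableFrom d' P :=
  fun l n s n' s' hn hn' => h l n s n' s' (hd.trans hn) (hd.trans hn')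

theorem StableFrom.keepSucc {d : ℕ} {P : ℕ × Bool × Bool → Prop} (h : StableFrom d P) :
    StableFrom (d + 1) fun x => P (keepSucc x) := by
  intro l n s n' s' hn hn'
  obtain ⟨n, rfl⟩ := Nat.exists_eq_add_of_le' (Nat.one_le_of_lt hn)
  obtain ⟨n', rfl⟩ := Nat.exists_eq_add_of_le' (Nat.one_le_of_lt hn')
  exact h _ _ _ _ _ (by omega) (by omega)

theorem StableFrom.flipSucc {d : ℕ} {P : ℕ × Bool × Bool → Prop} (h : StableFrom d P) :
    StableFrom (d + 1) fun x => P (flipSucc x) := by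
  intro l n s n' s' hn hn'
  obtain ⟨n, rfl⟩ := Nat.exists_eq_add_of_le' (Nat.one_le_of_lt hn)
  obtain ⟨n', rfl⟩ := Nat.exists_eq_add_of_le' (Nat.one_le_of_lt hn')
  cases s <;> cases s' <;> exact h _ _ _ _ _ (by omega) (by omega)

theorem StableFrom.count {d : ℕ} {P : ℕ × Bool × Bool → Prop} (h : StableFrom d P) (k : ℕ) :
    StableFrom (d + 1) fun x => ∃ S : Finset (ℕ × Bool × Bool), S.card = k ∧
      ∀ y ∈ S, LevelSucc x y ∧ P y := by
  have key : ∀ l n s n' s', d + 1 ≤ n → d + 1 ≤ n' →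
      (∃ S : Finset (ℕ × Bool × Bool), S.card = k ∧ ∀ y ∈ S, LevelSucc (n, l, s) y ∧ P y) →
      ∃ S : Finset (ℕ × Bool × Bool), S.card = k ∧ ∀ y ∈ S, LevelSucc (n', l, s') y ∧ P y := by
    -- The two successors correspond to those of the other vertex, kept label to kept label.
    rintro l n s n' s' hn hn' ⟨S, rfl, hS⟩
    have hne : HTA.keepSucc (n', l, s') ≠ HTA.flipSucc (n', l, s') := by
      obtain ⟨n', rfl⟩ := Nat.exists_eq_add_of_le' (Nat.one_le_of_lt hn')
      exact keepSucc_ne_flipSucc _ _ _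
    refine ⟨S.image fun y => if y = HTA.keepSucc (n, l, s) then HTA.keepSucc (n', l, s')
      else HTA.flipSucc (n', l, s'), Finset.card_image_of_injOn ?_, ?_⟩
    · intro y hy y' hy' e
      have h₁ := (hS y hy).1
      have h₂ := (hS y' hy').1
      dsimp only at e
      split_ifs at e with hk hk' hk'
      · exact hk.trans hk'.symm
      · exact absurd e hne
      · exact absurd e.symm hne
      · exact (h₁.resolve_left hk).trans (h₂.resolve_left hk').symm
    · intro z hz
      obtain ⟨y, hy, rfl⟩ := Finset.mem_image.1 hz
      obtain ⟨h₁, h₂⟩ := hS y hy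
      split_ifs with hk
      · subst hk
        exact ⟨.inl rfl, (h.keepSucc l n s n' s' hn hn').1 h₂⟩
      · obtain rfl := h₁.resolve_left hk
        exact ⟨.inr rfl, (h.flipSucc l n s n' s' hn hn').1 h₂⟩
  exact fun l n s n' s' hn hn' => ⟨key l n s n' s' hn hn', key l n' s' n s hn' hn⟩

theorem until_levelSucc_iff {P Q : ℕ × Bool × Bool → Prop} (x : ℕ × Bool × Bool) :
    Until LevelSucc P Q x ↔ Q x ∨ P x ∧
      (Until LevelSucc P Q (keepSucc x) ∨ Until LevelSucc P Q (flipSucc x)) := by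
  rw [until_iff]
  simp [LevelSucc, or_and_right, exists_or]

/-- A path for an until formula from above level `d` can keep or flip its label wherever both labels
are allowed, so what matters is which of the two vertices on level `d` it may start from there. -/
theorem StableFrom.until {d : ℕ} {P Q : ℕ × Bool × Bool → Prop} (hP : StableFrom d P)
    (hQ : StableFrom d Q) : StableFrom (d + 1) (Until LevelSucc P Q) := by
  set E := Until LevelSucc P Q
  have hE : ∀ x, E x ↔ Q x ∨ P x ∧ (E (HTA.keepSucc x) ∨ E (HTA.flipSucc x)) := until_levelSucc_iff
  have hp : ∀ l n s, d ≤ n → (P (n, l, s) ↔ P (d, l, false)) := fun l n s hn =>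
    hP l n s d false hn le_rfl
  have hq : ∀ l n s, d ≤ n → (Q (n, l, s) ↔ Q (d, l, false)) := fun l n s hn =>
    hQ l n s d false hn le_rfl
  have hqe : ∀ l, Q (d, l, false) → E (d, l, false) := fun l h => (hE _).2 (.inl h)
  have hpq : ∀ l, E (d, l, false) → Q (d, l, false) ∨ P (d, l, false) := fun l h =>
    ((hE _).1 h).imp id And.left
  have h₁ : ∀ l n, d ≤ n → E (d, l, false) → E (n, l, false) := by
    intro l n hn h
    induction n, hn using Nat.le_induction with
    | base => exact h
    | succ n hn ih =>
      rcases hpq l h with h' | h'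
      · exact (hE _).2 (.inl ((hq l _ _ (by omega)).2 h'))
      · exact (hE _).2 (.inr ⟨(hp l _ _ (by omega)).2 h', .inl ih⟩)
  have h₂ : ∀ l n s, d ≤ n → E (d, l, false) → E (n + 1, l, s) := by
    intro l n s hn h
    rcases hpq l h with h' | h'
    · exact (hE _).2 (.inl ((hq l _ _ (by omega)).2 h'))
    · exact (hE _).2 (.inr ⟨(hp l _ _ (by omega)).2 h', .inl (h₁ l n hn h)⟩)
  have h₃ : ∀ l n s, d ≤ n → P (d, l, false) → E (d, !l, false) → E (n + 1, l, s) := by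
    intro l n s hn h h'
    refine (hE _).2 (.inr ⟨(hp l _ _ (by omega)).2 h, .inr ?_⟩)
    cases s
    · exact h₁ _ n hn h'
    · exact h₂ _ n true hn h'
  have key : ∀ l n s, d ≤ n → (E (n + 1, l, s) ↔ Q (d, l, false) ∨ P (d, l, false) ∧
      (E (d, l, false) ∨ E (d, !l, false))) := by
    intro l n s hn
    constructor
    · intro h
      have := h.induction (C := fun x => E x ∧ ∀ l n s, d ≤ n → x = (n + 1, l, s) →
        Q (d, l, false) ∨ P (d, l, false) ∧ (E (d, l, false) ∨ E (d, !l, false))) ?_ ?_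
      · exact this.2 l n s hn rfl
      · refine fun x hx => ⟨(hE x).2 (.inl hx), ?_⟩
        rintro l n s hn rfl
        exact .inl ((hq l _ _ (by omega)).1 hx)
      · refine fun x y hx hxy ⟨hy, ih⟩ => ⟨until_iff.2 (.inr ⟨hx, y, hxy, hy⟩), ?_⟩
        rintro l n s hn rfl
        refine or_iff_not_imp_left.2 fun _ => ⟨(hp l _ _ (by omega)).1 hx, ?_⟩
        -- On level `d` the path has arrived; above it, the induction hypothesis applies.
        have hlow : ∀ l', y = (n, l', false) → E (d, l', false) ∨ E (d, !l', false) := by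
          rintro l' rfl
          rcases Nat.eq_or_lt_of_le hn with rfl | hlt
          · exact .inl hy
          · obtain ⟨n, rfl⟩ := Nat.exists_eq_add_of_le' (Nat.one_le_of_lt hlt)
            rcases ih l' n false (by omega) rfl with h | h
            · exact .inl (hqe _ h)
            · exact h.2
        rcases hxy with rfl | rfl
        · exact hlow l rfl
        · cases s
          · simpa [or_comm] using hlow (!l) rfl
          · rcases ih (!l) n true hn rfl with h | h
            · exact .inr (hqe _ h)
            · simpa [or_comm] using h.2
    · rintro (h | ⟨h, h' | h'⟩)
      · exact (hE _).2 (.inl ((hq l _ _ (by omega)).2 h))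
      · exact h₂ l n s hn h'
      · exact h₃ l n s hn h h'
  intro l n s n' s' hn hn'
  obtain ⟨n, rfl⟩ := Nat.exists_eq_add_of_le' (Nat.one_le_of_lt hn)
  obtain ⟨n', rfl⟩ := Nat.exists_eq_add_of_le' (Nat.one_le_of_lt hn')
  rw [key l n s (by omega), key l n' s' (by omega)]

section separation

variable {m : ℕ} (hm : 0 < m)

/-- The first proposition holds at the vertices with label `true`, and no other one anywhere. -/
def levelLabel (x : ℕ × Bool × Bool) : Letter m := if x.2.1 then {⟨0, hm⟩} else ∅

/-- High up, the two successors of a vertex carry the two labels whatever the position of the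
switch, and until formulae get down to low levels in either case, by `StableFrom.until`. -/
theorem exists_stableFrom (φ : Formula m) :
    ∃ d, StableFrom d (GraphSat LevelSucc (levelLabel hm) φ) := by
  induction φ with
  | atom p => exact ⟨0, fun l n s n' s' _ _ => Iff.rfl⟩
  | neg φ ih =>
    obtain ⟨d, h⟩ := ih
    exact ⟨d, fun l n s n' s' hn hn' => not_congr (h l n s n' s' hn hn')⟩
  | or φ ψ ih₁ ih₂ =>
    obtain ⟨d₁, h₁⟩ := ih₁
    obtain ⟨d₂, h₂⟩ := ih₂
    exact ⟨max d₁ d₂, fun l n s n' s' hn hn' =>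
      or_congr (h₁.mono (le_max_left _ _) l n s n' s' hn hn')
        (h₂.mono (le_max_right _ _) l n s n' s' hn hn')⟩
  | count k φ ih =>
    obtain ⟨d, h⟩ := ih
    exact ⟨d + 1, h.count k⟩
  | EX φ ih =>
    obtain ⟨d, h⟩ := ih
    refine ⟨d + 1, fun l n s n' s' hn hn' => ?_⟩
    simp only [GraphSat, LevelSucc, or_and_right, exists_or, exists_eq_left]
    exact or_congr (h.keepSucc l n s n' s' hn hn') (h.flipSucc l n s n' s' hn hn')
  | EU φ ψ ih₁ ih₂ =>
    obtain ⟨d₁, h₁⟩ := ih₁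
    obtain ⟨d₂, h₂⟩ := ih₂
    exact ⟨max d₁ d₂ + 1, (h₁.mono (le_max_left _ _)).until (h₂.mono (le_max_right _ _))⟩
  | EY φ => exact ⟨0, fun l n s n' s' _ _ => Iff.rfl⟩
  | ES φ ψ => exact ⟨0, fun l n s n' s' _ _ => Iff.rfl⟩

theorem mem_levelLabel (x : ℕ × Bool × Bool) : ⟨0, hm⟩ ∈ levelLabel hm x ↔ x.2.1 = true := by
  unfold levelLabel
  split_ifs with h <;> simp [h]

variable {hm} {t : SigmaTree (Letter m)} {e : t.Node → ℕ × Bool × Bool}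

theorem IsCover.alternates_iff (he : IsCover LevelSucc (levelLabel hm) t e) {u v : t.Node}
    (huv : t.succ u v) : Alternates hm t v ↔ ((e u).2.1 = true ↔ (e v).2.1 ≠ true) := by
  simp only [Alternates, he.label, mem_levelLabel]
  exact ⟨fun h => h u huv, fun h u' hu' => by rwa [t.pred_unique _ _ _ hu' huv]⟩

/-- With the switch off, going down with alternating labels leads to level `0`. -/
theorem IsCover.alternatingToThin (he : IsCover LevelSucc (levelLabel hm) t e) (n : ℕ) (u : t.Node)
    (l : Bool) (hu : e u = (n, l, false)) (ha : Alternates hm t u) : AlternatingToThin hm t u := by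
  induction n generalizing u l with
  | zero =>
    refine until_iff.2 (.inl ⟨ha, Nat.lt_succ_of_le ((Set.ncard_le_one (t.finite_succ u)).2
      fun v hv v' hv' => he.injOn hv hv' ?_)⟩)
    have h : ∀ v, t.succ u v → e v = (0, l, false) := by
      intro v hv
      have := he.succ hv
      rw [hu] at this
      exact this.elim id id
    exact (h v hv).trans (h v' hv').symm
  | succ n ih =>
    obtain ⟨v, hv, hev⟩ := he.exists_succ u (y := (n, !l, false)) (by rw [hu]; exact .inr rfl)
    refine until_iff.2 (.inr ⟨ha, v, hv, ih v (!l) hev ?_⟩)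
    refine (he.alternates_iff hv).2 ?_
    rw [hu, hev]
    cases l <;> simp

/-- With the switch on, alternating labels never lead down. -/
theorem IsCover.not_alternatingToThin (he : IsCover LevelSucc (levelLabel hm) t e) {n : ℕ}
    {u : t.Node} {l : Bool} (hu : e u = (n + 1, l, true)) : ¬ AlternatingToThin hm t u := by
  intro h
  have := h.induction (C := fun u => Alternates hm t u ∧ ∀ l, e u ≠ (n + 1, l, true)) ?_ ?_
  · exact this.2 l hu
  · rintro u ⟨ha, hthin⟩
    refine ⟨ha, fun l hu => ?_⟩
    obtain ⟨v, hv, hev⟩ := he.exists_succ u (y := keepSucc (e u)) (.inl rfl)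
    obtain ⟨v', hv', hev'⟩ := he.exists_succ u (y := flipSucc (e u)) (.inr rfl)
    have hne : v ≠ v' := by
      rintro rfl
      rw [hu] at hev hev'
      exact keepSucc_ne_flipSucc n l true (hev.symm.trans hev')
    exact absurd hthin (not_lt.2 ((Set.one_lt_ncard (t.finite_succ u)).2 ⟨v, hv, v', hv', hne⟩))
  · rintro u v ha huv ⟨hav, hv⟩
    refine ⟨ha, fun l hu => ?_⟩
    have hs := he.succ huv
    rw [hu] at hs
    rcases hs with hev | hev
    · have := (he.alternates_iff huv).1 hav
      rw [hu, hev] at this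
      cases l <;> simp [keepSucc] at this
    · exact hv _ hev

/-- No past-free formula defines the language. -/
theorem not_pastFree_definable {φ : Formula m} (hφ : φ.PastFree) :
    ¬ ∀ t, t ∈ φ.lang ↔ AlternatingToThin hm t t.root := by
  intro h
  obtain ⟨d, hd⟩ := exists_stableFrom hm φ
  obtain ⟨t, e, he, ht⟩ := exists_isCover levelSucc_finite levelSucc_total (levelLabel hm)
    (d, true, false)
  obtain ⟨t', e', he', ht'⟩ := exists_isCover levelSucc_finite levelSucc_total (levelLabel hm)
    (d + 1, true, true)
  have h₁ : φ.Sat t t.root := (h t).2 (he.alternatingToThin d _ true ht fun u hu =>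
    absurd hu (t.root_no_pred u))
  rw [he.sat_iff hφ, ht, hd true d false (d + 1) true le_rfl (by omega), ← ht', ← he'.sat_iff hφ]
    at h₁
  exact he'.not_alternatingToThin ht' ((h t').1 h₁)

end separation

end HTA

theorem mainTheorem9 (m : ℕ) (hm : 0 < m) :
    (HTA.linearHTA m).Equivalent (HTA.polCTL m) ∧
    (HTA.polCTL m).StrictlyLess (HTA.polPastCTL m) ∧
    (HTA.linearHTA m).StrictlyLess (HTA.twoWayLinearHTA m) := by
  refine ⟨⟨HTA.linearHTA_translatesTo_polCTL hm, HTA.polCTL_translatesTo_linearHTA m⟩,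
    ⟨⟨id, Computable.id, fun φ => ⟨φ.1, rfl, rfl⟩⟩, HTA.alternatingFormula hm, fun φ h => ?_⟩,
    HTA.linearHTA_translatesTo_twoWayLinearHTA m,
    ⟨HTA.alternatingAutomaton hm, HTA.alternatingAutomaton_isLinear hm⟩, fun A h => ?_⟩
  · exact HTA.not_pastFree_definable (hm := hm) φ.2 fun t =>
      (Set.ext_iff.1 h t).trans (HTA.mem_lang_alternatingFormula hm t)
  · obtain ⟨f, -, hf⟩ := HTA.linearHTA_translatesTo_polCTL hm
    obtain ⟨φ, -, hφ⟩ := hf A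
    exact HTA.not_pastFree_definable (hm := hm) φ.2 fun t =>
      (Set.ext_iff.1 (hφ.trans h) t).trans (HTA.mem_lang_alternatingAutomaton hm t)
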